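/- **Setting.** Let $\mathcal D_b$ be the complex vector space with orthonormal basis $\eta_{Q,\mathbf m}$, where $Q\in\mathbb Z$ and $\mathbf m=(m_1,m_2,\ldots)$, $m_n\in\mathbb N_0$, has only finitely many nonzero entries (finite linear combinations; $\langle\cdot|\cdot\rangle$ is linear in the second argument). On $\mathcal D_b$ let $c_n$ ($n\in\mathbb Z$) and $R$ be the operators of the Fock representation: for $n>0$, $c_n$ sends $\eta_{Q,\mathbf m}$ to $\sqrt{n\,m_n}\,\eta_{Q,\mathbf m-\mathbf e_n}$, $c_{-n}$ sends it to $\sqrt{n(m_n+1)}\,\eta_{Q,\mathbf m+\mathbf e_n}$, $c_0\eta_{Q,\mathbf m}=Q\,\eta_{Q,\mathbf m}$ and $R\,\eta_{Q,\mathbf m}=\eta_{Q+1,\mathbf m}$. Thus $[c_n,c_m]=n\delta_{n+m,0}$, $[c_n,R]=\delta_{n,0}R$, $c_n^\dagger=c_{-n}$, $R^\dagger=R^{-1}$. Write $|0\rangle=\eta_{0,\mathbf 0}$ and $|Q\rangle=R^Q|0\rangle$. Let $\nu_0>0$ and $\nu\in\mathbb R\setminus\{0\}$ be such that $\nu=r\nu_0$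 and $1/\nu=s\nu_0$ with integers $r,s$, and set $\mathcal Q=\nu_0c_0$. For $\mu\in\nu_0\mathbb Z$ and $x\in\mathbb C$ let $\phi_\mu(x)$ be the vertex operator $$\phi_\mu(x)=e^{-\mu\sum_{n<0}\frac{c_n}{n}e^{inx}}\;e^{-i\mu\mathcal Qx/2}\,R^{\mu/\nu_0}\,e^{-i\mu\mathcal Qx/2}\;e^{-\mu\sum_{n>0}\frac{c_n}{n}e^{inx}},$$ a quadratic form on $\mathcal D_b$, i.e. a sesquilinear form $(\eta,\eta')\mapsto\langle\eta|\phi_\mu(x)|\eta'\rangle$ (the leftmost exponential acts on $\eta$ through its adjoint). Products of quadratic forms are formed by summing over the basis of intermediate states. Let $$\Phi^{N,M}_\nu(\mathbf x,\mathbf y)=\phi_\nu(x_1)\cdots\phi_\nu(x_N)\,\phi_{-1/\nu}(y_1)\cdots\phi_{-1/\nu}(y_M).$$ Let $$\mathcal H^{\nu,1}=\tfrac1\nu\mathcal Q,\qquad \mathcal H^{\nu,2}=\tfrac12\mathcal Q^2+\sum_{n>0}c_{-n}c_n,$$ $$\mathcal H^{\nu,3}=\frac\nu3\sum_{\substack{n,m,\ell\neq0\\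 n+m+\ell=0}}{:}c_nc_mc_\ell{:}+\sum_{n>0}\bigl[(1-\nu^2)n+2\nu\mathcal Q\bigr]c_{-n}c_n+\frac\nu3\mathcal Q^3-\frac{\nu^3}{12}\mathcal Q,$$ where ${:}\cdots{:}$ moves the $c_n$ with $n>0$ to the right. Finally let $$D_{N,M}=-i\Bigl(\sum_{j}\partial_{x_j}+\sum_k\partial_{y_k}\Bigr),$$ $$\begin{aligned}H_{N,M}(\mathbf x,\mathbf y;g)={}&-\sum_{j=1}^N\partial_{x_j}^2+\sum_{1\le j<j'\le N}\frac{g(g-1)}{2\sin^2\frac12(x_j-x_{j'})}+g\sum_{k=1}^M\partial_{y_k}^2\\&+\sum_{1\le k<k'\le M}\frac{(g-1)/g}{2\sin^2\frac12(y_k-y_{k'})}+\sum_{j=1}^N\sum_{k=1}^M\frac{1-g}{2\sin^2\frac12(x_j-y_k)}\end{aligned}$$ be the differential operators of the deformed Calogero–Sutherland model. **Theorem.** Let $N,M\in\mathbb N_0$ and $Q\in\mathbb Z$. On the domain of all $(\mathbf x,\mathbf y)\in\mathbb C^N\times\mathbb C^M$ with $$0>\operatorname{Im}x_1>\cdots>\operatorname{Im}x_N>\operatorname{Im}y_1>\cdots>\operatorname{Im}y_M,$$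 the product $\Phi^{N,M}_\nu(\mathbf x,\mathbf y)$ and its commutators with $\mathcal H^{\nu,1},\mathcal H^{\nu,2},\mathcal H^{\nu,3}$ are well-defined quadratic forms on $\mathcal D_b$ (all sums over intermediate basis states, formed one factor at a time from the right, converge absolutely); for every $\eta\in\mathcal D_b$ the function $\langle\eta|\Phi^{N,M}_\nu(\mathbf x,\mathbf y)|Q\rangle$ is holomorphic in $(\mathbf x,\mathbf y)$; and, as identities between matrix elements with all $\eta\in\mathcal D_b$ on the left, $$[\mathcal H^{\nu,1},\Phi^{N,M}_\nu(\mathbf x,\mathbf y)]\,|Q\rangle=(N-M\nu^{-2})\,\Phi^{N,M}_\nu(\mathbf x,\mathbf y)\,|Q\rangle,$$ $$[\mathcal H^{\nu,2},\Phi^{N,M}_\nu(\mathbf x,\mathbf y)]\,|Q\rangle=-D_{N,M}\,\Phi^{N,M}_\nu(\mathbf x,\mathbf y)\,|Q\rangle,$$ $$[\mathcal H^{\nu,3},\Phi^{N,M}_\nu(\mathbf x,\mathbf y)]\,|Q\rangle=\Bigl(H_{N,M}(\mathbf x,\mathbf y;\nu^2)+\tfrac1{12}(\nu^2-\nu^{-2})M\Bigr)\Phi^{N,M}_\nu(\mathbf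 x,\mathbf y)\,|Q\rangle.$$ -/

import Mathlib

open scoped BigOperators ComplexConjugate

namespace ChiralBoson

noncomputable section

/-! ### The boson states and the oscillator algebra -/

/-- Labels of the orthonormal boson states: a charge `Q : ℤ` together with finitely many
nonzero occupation numbers `m n`, one for each oscillator mode `n = 1, 2, 3, …`. -/
abbrev Label : Type := ℤ × (ℕ+ →₀ ℕ)

/-- The space of finite boson states: finite linear combinations of the orthonormal states
`ket (Q, m)`, where `ket (Q, m)` is the normalised state
`∏ₙ (n ^ mₙ mₙ!) ^ (-1/2) c₋ₙ ^ mₙ R ^ Q |0⟩`.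
(The Fock space is its Hilbert space completion, the square summable functions on `Label`.) -/
abbrev FiniteState : Type := Label →₀ ℂ

/-- Linear operators on the finite boson states. -/
abbrev Op : Type := FiniteState →ₗ[ℂ] FiniteState

/-- The orthonormal boson state with a given label. -/
def ket (b : Label) : FiniteState := Finsupp.single b 1

/-- The inner product `⟨η | η'⟩`, linear in the second argument, for which the kets are
orthonormal. -/
def braket (η η' : FiniteState) : ℂ := η.sum fun b a => conj a * η' b

/-- The linear operator with prescribed values on the orthonormal basis. -/
def opOfBasis (f : Label → FiniteState) : Op := Finsupp.linearCombination ℂ f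

/-- The annihilation operator `c_n`, `n > 0`. -/
def annihilate (n : ℕ+) : Op :=
  opOfBasis fun b =>
    ((Real.sqrt ((n : ℝ) * (b.2 n : ℝ)) : ℝ) : ℂ) • ket (b.1, b.2 - Finsupp.single n 1)

/-- The creation operator `c_{-n}`, `n > 0`. -/
def create (n : ℕ+) : Op :=
  opOfBasis fun b =>
    ((Real.sqrt ((n : ℝ) * ((b.2 n : ℝ) + 1)) : ℝ) : ℂ) • ket (b.1, b.2 + Finsupp.single n 1)

/-- The charge operator `c_0`. -/
def charge : Op := opOfBasis fun b => (b.1 : ℂ) • ket b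

/-- The operators `c_n` for all integers `n`. -/
def mode : ℤ → Op
  | Int.ofNat 0 => charge
  | Int.ofNat (k + 1) => annihilate (Nat.succPNat k)
  | Int.negSucc k => create (Nat.succPNat k)

/-- The charge raising operator `R`; it is unitary, with inverse `R† = R⁻¹`. Its integer powers
are the powers in the group of linear automorphisms. -/
def raiseCharge : FiniteState ≃ₗ[ℂ] FiniteState :=
  Finsupp.domLCongr ((Equiv.addRight (1 : ℤ)).prodCongr (Equiv.refl (ℕ+ →₀ ℕ)))

/-- The vacuum `|0⟩`. -/
def vacuum : FiniteState := ket (0, 0)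

/-- The charge states `|Q⟩ = R ^ Q |0⟩`. -/
def chargeState (Q : ℤ) : FiniteState := (raiseCharge ^ Q) vacuum

/-! ### Locally finite sums and exponentials of operators -/

/-- The sum of a family of operators of which only finitely many are nonzero on each ket. -/
def opSum {α : Type} (T : α → Op) : Op := opOfBasis fun b => ∑ᶠ a, T a (ket b)

/-- The exponential of a locally nilpotent operator (on each ket, the exponential series has only
finitely many nonzero terms). -/
def opExp (A : Op) : Op := opOfBasis fun b => ∑ᶠ k : ℕ, ((k.factorial : ℂ)⁻¹) • (A ^ k) (ket b)

/-- The normal ordered product of the modes with indices in a list: the modes with positive index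
are moved to the right. Nothing has to be done about `c_0`, which commutes with all
modes. -/
def normalOrdered (L : List ℤ) : Op :=
  ((L.filter fun n => n ≤ 0).map mode).prod * ((L.filter fun n => 0 < n).map mode).prod

/-! ### Quadratic forms on the finite boson states -/

/-- A quadratic (that is, sesquilinear) form `A` on the finite boson states, given by its
matrix elements `⟨b | A | b'⟩` in the orthonormal basis of kets. -/
abbrev QForm : Type := Label → Label → ℂ

/-- The value `⟨η | A | η'⟩` of a quadratic form on two finite boson states. -/
def QForm.eval (A : QForm) (η η' : FiniteState) : ℂ :=
  η.sum fun b a => η'.sum fun b' a' => conj a * A b b' * a'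

/-- The quadratic form of an operator on the finite boson states. -/
def QForm.ofOp (T : Op) : QForm := fun b b' => braket (ket b) (T (ket b'))

/-- The product of two quadratic forms, with a sum over a complete set of intermediate states. -/
def QForm.prod (A B : QForm) : QForm := fun b b' => ∑' c, A b c * B c b'

/-- The product of two quadratic forms is well-defined: the sums over intermediate states
converge absolutely. -/
def QForm.ProdDefined (A B : QForm) : Prop := ∀ b b', Summable fun c => A b c * B c b'

/-- The product `A₁ A₂ ⋯ A_K` of a list of quadratic forms; the empty product is the identity. -/
def QForm.listProd : List QForm → QForm
  | [] => QForm.ofOp 1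
  | A :: L => QForm.prod A (QForm.listProd L)

/-- All the sums over intermediate states in the product of a list converge absolutely. -/
def QForm.ListProdDefined : List QForm → Prop
  | [] => True
  | A :: L => QForm.ListProdDefined L ∧ QForm.ProdDefined A (QForm.listProd L)

/-- The commutator `[T, A] = T A - A T` of an operator and a quadratic form. -/
def QForm.commutator (T : Op) (A : QForm) : QForm :=
  fun b b' => QForm.prod (QForm.ofOp T) A b b' - QForm.prod A (QForm.ofOp T) b b'

/-- Both products in the commutator of an operator and a quadratic form are well-defined. -/
def QForm.CommutatorDefined (T : Op) (A : QForm) : Prop :=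
  QForm.ProdDefined (QForm.ofOp T) A ∧ QForm.ProdDefined A (QForm.ofOp T)

/-! ### Vertex operators -/

/-- `𝒬 = ν₀ c_0`. -/
def scaledCharge (ν₀ : ℝ) : Op := (ν₀ : ℂ) • charge

/-- `exp (t 𝒬)`, which is diagonal in the basis of kets. -/
def expScaledCharge (ν₀ : ℝ) (t : ℂ) : Op :=
  opOfBasis fun b => Complex.exp (t * (ν₀ * b.1)) • ket b

/-- `exp (-ν ∑_{n > 0} (c_n / n) e^{i n x})`. -/
def annihilationExp (ν : ℝ) (x : ℂ) : Op :=
  opExp (opSum fun n : ℕ+ =>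
    (-(ν : ℂ) * Complex.exp (Complex.I * (n : ℂ) * x) / (n : ℂ)) • mode (n : ℤ))

/-- The adjoint of `exp (-ν ∑_{n < 0} (c_n / n) e^{i n x})`; with `n = -k` and `c_n† = c_{-n}` this
is `exp (-ν ∑_{k > 0} (c_k / (-k)) conj (e^{-i k x}))`. -/
def creationExpAdjoint (ν : ℝ) (x : ℂ) : Op :=
  opExp (opSum fun k : ℕ+ =>
    (-(ν : ℂ) * conj (Complex.exp (-(Complex.I * (k : ℂ) * x))) / (-(k : ℂ))) • mode (k : ℤ))

/-- The vertex operator `φ_ν(x)` with statistics parameter `ν = ℓ ν₀`, `ℓ : ℤ`, as the quadratic form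
`exp (-ν ∑_{n < 0} (c_n / n) e^{i n x}) e^{-i ν 𝒬 x / 2} R ^ ℓ e^{-i ν 𝒬 x / 2}
exp (-ν ∑_{n > 0} (c_n / n) e^{i n x})`; the first factor acts on the left argument, through its
adjoint. -/
def vertex (ν₀ : ℝ) (ℓ : ℤ) (x : ℂ) : QForm := fun b b' =>
  let ν : ℝ := ℓ * ν₀
  let E : Op := expScaledCharge ν₀ (-Complex.I * (ν : ℂ) * x / 2)
  braket (creationExpAdjoint ν x (ket b))
    (E ((raiseCharge ^ ℓ) (E (annihilationExp ν x (ket b')))))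

/-- The factors of `φ_{rν₀}(x₁) ⋯ φ_{rν₀}(x_N) φ_{-sν₀}(y₁) ⋯ φ_{-sν₀}(y_M)`. -/
def anyonFactors (ν₀ : ℝ) (r s : ℤ) {N M : ℕ} (p : (Fin N → ℂ) × (Fin M → ℂ)) : List QForm :=
  (List.ofFn fun j => vertex ν₀ r (p.1 j)) ++ (List.ofFn fun k => vertex ν₀ (-s) (p.2 k))

/-- The product of anyons with statistics parameters `ν = rν₀` and `-1/ν = -sν₀`. -/
def anyonProduct (ν₀ : ℝ) (r s : ℤ) {N M : ℕ} (p : (Fin N → ℂ) × (Fin M → ℂ)) : QForm :=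
  QForm.listProd (anyonFactors ν₀ r s p)

/-- The domain `0 > Im x₁ > ⋯ > Im x_N > Im y₁ > ⋯ > Im y_M`. -/
def orderedDomain (N M : ℕ) : Set ((Fin N → ℂ) × (Fin M → ℂ)) :=
  {p | (∀ j, (Fin.append p.1 p.2 j).im < 0) ∧ StrictAnti fun j => (Fin.append p.1 p.2 j).im}

/-! ### The three operators of the conformal field theory -/

/-- The charge operator `𝒬 / ν`. -/
def H₁ (ν₀ ν : ℝ) : Op := (1 / (ν : ℂ)) • scaledCharge ν₀

/-- The CFT Hamiltonian `𝒬² / 2 + ∑_{n > 0} c_{-n} c_n`. -/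
def H₂ (ν₀ : ℝ) : Op :=
  (1 / 2 : ℂ) • scaledCharge ν₀ ^ 2 + opSum fun n : ℕ+ => mode (-(n : ℤ)) * mode (n : ℤ)

/-- Triples of nonzero integers with sum zero. -/
abbrev ZeroSumTriple : Type :=
  {t : ℤ × ℤ × ℤ // t.1 ≠ 0 ∧ t.2.1 ≠ 0 ∧ t.2.2 ≠ 0 ∧ t.1 + t.2.1 + t.2.2 = 0}

/-- The collective field Hamiltonian
`(ν/3) ∑ :c_n c_m c_ℓ: + ∑_{n > 0} ((1 - ν²) n + 2 ν 𝒬) c_{-n} c_n + (ν/3) 𝒬³ - (ν³/12) 𝒬`,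
the first sum over nonzero `n, m, ℓ` with `n + m + ℓ = 0`. -/
def H₃ (ν₀ ν : ℝ) : Op :=
  ((ν : ℂ) / 3) • (opSum fun t : ZeroSumTriple => normalOrdered [t.1.1, t.1.2.1, t.1.2.2])
    + (opSum fun n : ℕ+ =>
        (((1 - (ν : ℂ) ^ 2) * (n : ℂ)) • (1 : Op) + (2 * (ν : ℂ)) • scaledCharge ν₀)
          * mode (-(n : ℤ)) * mode (n : ℤ))
    + ((ν : ℂ) / 3) • scaledCharge ν₀ ^ 3
    - ((ν : ℂ) ^ 3 / 12) • scaledCharge ν₀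

/-! ### The differential operators of the deformed Calogero-Sutherland model -/

/-- `∂^k f / ∂x_j^k`. -/
def partialX {N M : ℕ} (k : ℕ) (j : Fin N) (f : (Fin N → ℂ) × (Fin M → ℂ) → ℂ)
    (p : (Fin N → ℂ) × (Fin M → ℂ)) : ℂ :=
  iteratedDeriv k (fun t => f (Function.update p.1 j t, p.2)) (p.1 j)

/-- `∂^k f / ∂y_j^k`. -/
def partialY {N M : ℕ} (k : ℕ) (j : Fin M) (f : (Fin N → ℂ) × (Fin M → ℂ) → ℂ)
    (p : (Fin N → ℂ) × (Fin M → ℂ)) : ℂ :=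
  iteratedDeriv k (fun t => f (p.1, Function.update p.2 j t)) (p.2 j)

/-- `D_{N,M} f = -i (∑_j ∂f/∂x_j + ∑_k ∂f/∂y_k)`. -/
def momentumOp {N M : ℕ} (f : (Fin N → ℂ) × (Fin M → ℂ) → ℂ)
    (p : (Fin N → ℂ) × (Fin M → ℂ)) : ℂ :=
  -Complex.I * (∑ j, partialX 1 j f p + ∑ k, partialY 1 k f p)

/-- The interaction `1 / (2 sin² (u / 2))`. -/
def pairPotential (u : ℂ) : ℂ := 1 / (2 * Complex.sin (u / 2) ^ 2)

/-- The deformed Calogero-Sutherland operator `H_{N,M}(x, y; g)`. -/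
def deformedCS {N M : ℕ} (g : ℂ) (f : (Fin N → ℂ) × (Fin M → ℂ) → ℂ)
    (p : (Fin N → ℂ) × (Fin M → ℂ)) : ℂ :=
  -(∑ j, partialX 2 j f p)
    + (∑ j, ∑ j' ∈ Finset.Ioi j, g * (g - 1) * pairPotential (p.1 j - p.1 j')) * f p
    + g * (∑ k, partialY 2 k f p)
    + (∑ k, ∑ k' ∈ Finset.Ioi k, (g - 1) / g * pairPotential (p.2 k - p.2 k')) * f p
    + (∑ j, ∑ k, (1 - g) * pairPotential (p.1 j - p.2 k)) * f p

end

end ChiralBoson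

open ChiralBoson

/-!
The product of vertex operators is normal ordered: up to a scalar on each charge sector it is
`exp (∑ αₙ c_{-n} / n) R ^ Λ exp (∑ βₙ c_n / n)`. A form of this kind is determined by its
intertwining relations with the modes and by its matrix elements between charge states, which is how
it is encoded here (`IsVertexForm`). The relations let absolute convergence of all sums over
intermediate states, and the normal ordering of a product, be reduced by induction on the occupation
numbers to charge states, where the sum over intermediate states is a product of exponential series,
one for each mode (`IsVertexForm.prod`, `hasSum_exp_prod`). For vertex operators it converges because
`|e^{i (x - y)}| < 1` for `Im x > Im y`, and it produces the pair factors
`(1 - e^{i (x - y)}) ^ (μ μ')` (`vertexProduct_spec`).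

With the state `|Q⟩` on the right this gives a functional `Ψ` on which `c_{-n}` acts as multiplication
by the power sum `Pₙ = ∑ⱼ μⱼ zⱼ ^ n`, `zⱼ = e^{-i uⱼ}`, and `c_n` as `n ∂ / ∂Pₙ`; so derivatives in the
positions become insertions of `∑ₙ zⱼ ^ n c_n` (`hasDerivAt_functional`,
`iteratedDeriv_two_vertexFunctional`). The Hamiltonians are symmetric, hence act on `Ψ` through their
action on the left state, and the collective field Hamiltonian becomes an expression in the `Pₙ` and
`c_n` (`IsCoherent.H₃_ket`). It is compared with `∑ⱼ (ν / μⱼ) (-∂ⱼ ^ 2) Ψ` (`vertexFunctional_H₃`).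
The scalar terms agree up to pair potentials by the three-term identity for
`w_{jk} = zⱼ / (zⱼ - z_k)` (`pairWeight_triple`). The terms linear in `c_n` agree by summing geometric
progressions (`sum_pairWeight_pow`), and here the relation `ν (1 - μ ^ 2) = (1 - ν ^ 2) μ` is needed,
whose only solutions are the two statistics parameters `μ = ν` and `μ = -1 / ν`.
-/

namespace ChiralBoson

noncomputable section

/-! ### The oscillator algebra in the basis of kets -/

lemma op_ext {S T : Op} (h : ∀ b, S (ket b) = T (ket b)) : S = T := by
  refine Finsupp.lhom_ext' fun b => LinearMap.ext_ring ?_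
  exact h b

lemma single_eq_smul_ket (b : Label) (a : ℂ) : Finsupp.single b a = a • ket b := by
  simp [ket]

lemma ket_apply (b c : Label) : ket b c = if b = c then 1 else 0 := by
  simp [ket, Finsupp.single_apply]

@[simp] lemma opOfBasis_ket (f : Label → FiniteState) (b : Label) :
    opOfBasis f (ket b) = f b := by
  simp [opOfBasis, ket]

lemma annihilate_ket (n : ℕ+) (b : Label) : annihilate n (ket b) =
    ((Real.sqrt ((n : ℝ) * (b.2 n : ℝ)) : ℝ) : ℂ) • ket (b.1, b.2 - Finsupp.single n 1) :=
  opOfBasis_ket _ _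

lemma create_ket (n : ℕ+) (b : Label) : create n (ket b) =
    ((Real.sqrt ((n : ℝ) * ((b.2 n : ℝ) + 1)) : ℝ) : ℂ) • ket (b.1, b.2 + Finsupp.single n 1) :=
  opOfBasis_ket _ _

lemma charge_ket (b : Label) : charge (ket b) = (b.1 : ℂ) • ket b := opOfBasis_ket _ _

lemma mode_natCast (n : ℕ+) : mode ((n : ℕ) : ℤ) = annihilate n := by
  obtain ⟨k, rfl⟩ : ∃ k, n = Nat.succPNat k := ⟨n.natPred, (PNat.succPNat_natPred n).symm⟩
  rfl

lemma mode_neg_natCast (n : ℕ+) : mode (-((n : ℕ) : ℤ)) = create n := by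
  obtain ⟨k, rfl⟩ : ∃ k, n = Nat.succPNat k := ⟨n.natPred, (PNat.succPNat_natPred n).symm⟩
  rfl

lemma annihilate_ket_of_eq_zero {n : ℕ+} {b : Label} (h : b.2 n = 0) :
    annihilate n (ket b) = 0 := by
  simp [annihilate_ket, h]

lemma annihilate_comm (n m : ℕ+) : annihilate n * annihilate m = annihilate m * annihilate n := by
  rcases eq_or_ne n m with rfl | hnm
  · rfl
  refine op_ext fun b => ?_
  simp only [Module.End.mul_apply, annihilate_ket, map_smul, smul_smul, Finsupp.tsub_apply,
    Finsupp.single_eq_of_ne hnm, Finsupp.single_eq_of_ne hnm.symm, tsub_zero]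
  rw [tsub_right_comm, mul_comm]

lemma ofReal_sqrt_mul_self {a : ℝ} (h : 0 ≤ a) : ((√a : ℝ) : ℂ) * ((√a : ℝ) : ℂ) = (a : ℂ) := by
  rw [← Complex.ofReal_mul, Real.mul_self_sqrt h]

/-- The number operator `c_{-n} c_n` is diagonal. -/
lemma create_annihilate_ket (n : ℕ+) (b : Label) :
    create n (annihilate n (ket b)) = ((n : ℂ) * (b.2 n : ℂ)) • ket b := by
  rcases Nat.eq_zero_or_pos (b.2 n) with h | h
  · simp [annihilate_ket_of_eq_zero h, h]
  · have h1 : ((b.2 n - 1 : ℕ) : ℝ) + 1 = (b.2 n : ℝ) := by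
      rw [Nat.cast_sub h]; simp
    simp only [annihilate_ket, map_smul, create_ket, smul_smul, Finsupp.tsub_apply,
      Finsupp.single_eq_same, h1]
    rw [ofReal_sqrt_mul_self (by positivity), tsub_add_cancel_of_le (by simpa using Nat.succ_le_of_lt h)]
    simp

lemma annihilate_create_of_ne {n m : ℕ+} (h : n ≠ m) :
    annihilate n * create m = create m * annihilate n := by
  refine op_ext fun b => ?_
  rcases Nat.eq_zero_or_pos (b.2 n) with h0 | h0
  · rw [Module.End.mul_apply, Module.End.mul_apply, annihilate_ket_of_eq_zero h0, create_ket,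
      map_smul, annihilate_ket_of_eq_zero (by simp [h0, Finsupp.single_eq_of_ne h])]
    simp
  · simp only [Module.End.mul_apply, annihilate_ket, create_ket, map_smul, smul_smul,
      Finsupp.add_apply, Finsupp.tsub_apply, Finsupp.single_eq_of_ne h,
      Finsupp.single_eq_of_ne h.symm, add_zero, tsub_zero]
    rw [mul_comm, tsub_add_eq_add_tsub (by simpa using Nat.succ_le_of_lt h0)]

lemma annihilate_create_self (n : ℕ+) :
    annihilate n * create n = create n * annihilate n + (n : ℂ) • (1 : Op) := by
  refine op_ext fun b => ?_
  rw [LinearMap.add_apply, Module.End.mul_apply, Module.End.mul_apply, create_annihilate_ket]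
  simp only [annihilate_ket, create_ket, map_smul, smul_smul, Finsupp.add_apply,
    Finsupp.single_eq_same, add_tsub_cancel_right, Nat.cast_add, Nat.cast_one]
  rw [ofReal_sqrt_mul_self (by positivity), LinearMap.smul_apply, Module.End.one_apply, ← add_smul]
  push_cast
  ring_nf

lemma annihilate_create (n m : ℕ+) :
    annihilate n * create m = create m * annihilate n + (if n = m then (n : ℂ) else 0) • (1 : Op) := by
  split_ifs with h
  · subst h; exact annihilate_create_self n
  · rw [annihilate_create_of_ne h, zero_smul, add_zero]

lemma annihilate_charge (n : ℕ+) : annihilate n * charge = charge * annihilate n := by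
  refine op_ext fun b => ?_
  simp [charge_ket, annihilate_ket, smul_smul, mul_comm]

lemma op_apply_comm {S T : Op} (h : S * T = T * S) (η : FiniteState) : S (T η) = T (S η) := by
  rw [← Module.End.mul_apply, h, Module.End.mul_apply]

/-! ### Linear combinations of annihilation operators -/

lemma opSum_ket {α : Type} (T : α → Op) (b : Label) : opSum T (ket b) = ∑ᶠ a, T a (ket b) :=
  opOfBasis_ket _ _

lemma opSum_ket_eq_sum {α : Type} (T : α → Op) (b : Label) (S : Finset α)
    (h : ∀ a ∉ S, T a (ket b) = 0) : opSum T (ket b) = ∑ a ∈ S, T a (ket b) := by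
  rw [opSum_ket]
  refine finsum_eq_sum_of_support_subset _ fun a ha => ?_
  by_contra hS
  exact ha (h a hS)

/-- The infinite linear combination `∑ₙ γₙ c_n` of annihilation operators. -/
def lowering (γ : ℕ+ → ℂ) : Op := opSum fun n => γ n • annihilate n

lemma lowering_ket (γ : ℕ+ → ℂ) (b : Label) (S : Finset ℕ+) (hS : b.2.support ⊆ S) :
    lowering γ (ket b) = ∑ n ∈ S, γ n • annihilate n (ket b) := by
  refine opSum_ket_eq_sum _ _ _ fun n hn => ?_
  have h : b.2 n = 0 := by
    by_contra h
    exact hn (hS (Finsupp.mem_support_iff.2 h))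
  simp [annihilate_ket_of_eq_zero h]

lemma lowering_vacuum (γ : ℕ+ → ℂ) (Q : ℤ) : lowering γ (ket (Q, 0)) = 0 := by
  rw [lowering_ket γ _ ∅ (by simp)]; simp

lemma lowering_create (γ : ℕ+ → ℂ) (n : ℕ+) :
    lowering γ * create n = create n * lowering γ + (γ n * n) • (1 : Op) := by
  classical
  refine op_ext fun b => ?_
  set S := insert n b.2.support with hS
  have h1 : lowering γ (create n (ket b)) = ∑ k ∈ S, γ k • annihilate k (create n (ket b)) := by
    rw [create_ket, map_smul, lowering_ket γ _ S, Finset.smul_sum]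
    · refine Finset.sum_congr rfl fun k _ => ?_
      rw [map_smul, smul_comm]
    · refine Finsupp.support_add.trans ?_
      rw [hS]
      exact Finset.union_subset (Finset.subset_insert _ _)
        (Finsupp.support_single_subset.trans (by simp))
  rw [LinearMap.add_apply, Module.End.mul_apply, Module.End.mul_apply, h1,
    lowering_ket γ b S (Finset.subset_insert _ _), map_sum]
  have h2 : ∀ k, annihilate k (create n (ket b)) = create n (annihilate k (ket b)) +
      (if k = n then (k : ℂ) else 0) • ket b := fun k => by
    rw [← Module.End.mul_apply, annihilate_create]; rfl
  simp only [h2, smul_add, Finset.sum_add_distrib, map_smul]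
  congr 1
  rw [Finset.sum_eq_single n (fun k _ hk => by simp [hk]) (fun h => (h (by simp [hS])).elim)]
  simp [smul_smul]

lemma lowering_comm_of_forall {T : Op} (hT : ∀ b, ∃ (a : ℂ) (c : Label), c.2.support ⊆ b.2.support ∧
      T (ket b) = a • ket c) (h : ∀ n, annihilate n * T = T * annihilate n) (γ : ℕ+ → ℂ) :
    lowering γ * T = T * lowering γ := by
  refine op_ext fun b => ?_
  obtain ⟨a, c, hc, hb⟩ := hT b
  rw [Module.End.mul_apply, Module.End.mul_apply, lowering_ket γ b _ subset_rfl, map_sum, hb,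
    map_smul, lowering_ket γ c _ hc, Finset.smul_sum]
  refine Finset.sum_congr rfl fun n _ => ?_
  rw [map_smul, ← op_apply_comm (h n), hb, map_smul, smul_comm]

lemma lowering_annihilate (γ : ℕ+ → ℂ) (n : ℕ+) :
    lowering γ * annihilate n = annihilate n * lowering γ :=
  lowering_comm_of_forall (fun b => ⟨_, _, Finsupp.support_tsub, annihilate_ket n b⟩)
    (fun m => annihilate_comm m n) γ

lemma lowering_charge (γ : ℕ+ → ℂ) : lowering γ * charge = charge * lowering γ :=
  lowering_comm_of_forall (fun b => ⟨_, _, subset_rfl, charge_ket b⟩) annihilate_charge γ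

/-- A combination of annihilation operators lowers the total occupation number, so it is locally
nilpotent. -/
lemma lowering_pow_ket (γ : ℕ+ → ℂ) (d : ℕ) :
    ∀ b : Label, b.2.degree < d → (lowering γ ^ d) (ket b) = 0 := by
  induction d with
  | zero => intro b hb; exact absurd hb (Nat.not_lt_zero _)
  | succ d ih =>
    intro b hb
    rw [pow_succ, Module.End.mul_apply, lowering_ket γ b _ subset_rfl, map_sum]
    refine Finset.sum_eq_zero fun n hn => ?_
    rw [annihilate_ket, map_smul, map_smul, ih, smul_zero, smul_zero]
    have hn' : b.2 n ≠ 0 := Finsupp.mem_support_iff.1 hn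
    have h1 : b.2 - Finsupp.single n 1 + Finsupp.single n 1 = b.2 :=
      tsub_add_cancel_of_le (by simpa using Nat.one_le_iff_ne_zero.2 hn')
    have h2 := congrArg Finsupp.degree h1
    rw [map_add, Finsupp.degree_single] at h2
    simp only
    omega

/-! ### Exponentials of locally nilpotent operators -/

/-- An operator some power of which annihilates each ket. -/
def LocallyNilpotent (A : Op) : Prop := ∀ b, ∃ d, (A ^ d) (ket b) = 0

lemma lowering_locallyNilpotent (γ : ℕ+ → ℂ) : LocallyNilpotent (lowering γ) :=
  fun b => ⟨b.2.degree + 1, lowering_pow_ket γ _ b (Nat.lt_succ_self _)⟩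

lemma opExp_eventually {A : Op} (hA : LocallyNilpotent A) (η : FiniteState) :
    ∀ᶠ K in Filter.atTop, opExp A η =
      ∑ k ∈ Finset.range K, ((k.factorial : ℂ)⁻¹) • (A ^ k) η := by
  induction η using Finsupp.induction_linear with
  | zero => simp
  | add f g hf hg =>
    filter_upwards [hf, hg] with K h1 h2
    rw [map_add, h1, h2, ← Finset.sum_add_distrib]
    simp
  | single b a =>
    obtain ⟨d, hd⟩ := hA b
    filter_upwards [Filter.eventually_ge_atTop d] with K hK
    rw [single_eq_smul_ket, map_smul, opExp, opOfBasis_ket,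
      finsum_eq_sum_of_support_subset (s := Finset.range K), Finset.smul_sum]
    · refine Finset.sum_congr rfl fun k _ => ?_
      rw [map_smul, smul_comm]
    · intro k hk
      by_contra h
      refine hk ?_
      have : d ≤ k := hK.trans (by simpa using h)
      simp only
      rw [← Nat.sub_add_cancel this, pow_add, Module.End.mul_apply, hd, map_zero, smul_zero]

lemma opExp_comm {A T : Op} (hA : LocallyNilpotent A) (h : A * T = T * A) :
    opExp A * T = T * opExp A := by
  refine LinearMap.ext fun η => ?_
  obtain ⟨K, h1, h2⟩ := ((opExp_eventually hA (T η)).and (opExp_eventually hA η)).exists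
  rw [Module.End.mul_apply, Module.End.mul_apply, h1, h2, map_sum]
  refine Finset.sum_congr rfl fun k _ => ?_
  rw [map_smul, op_apply_comm ((Commute.pow_left h k).eq)]

/-- If `[A, T] = a` is a scalar then `[exp A, T] = a exp A`. -/
lemma opExp_comm_scalar {A T : Op} (hA : LocallyNilpotent A) {a : ℂ}
    (h : A * T = T * A + a • (1 : Op)) : opExp A * T = T * opExp A + a • opExp A := by
  have hpow : ∀ k : ℕ, A ^ (k + 1) * T = T * A ^ (k + 1) + ((k + 1 : ℂ) * a) • A ^ k := by
    intro k
    induction k with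
    | zero => simpa using h
    | succ k ih =>
      rw [pow_succ', mul_assoc, ih, mul_add, ← mul_assoc, h, add_mul, mul_smul_comm, ← pow_succ',
        mul_assoc, ← pow_succ', smul_mul_assoc, one_mul, add_assoc, ← add_smul]
      push_cast
      ring_nf
  refine LinearMap.ext fun η => ?_
  obtain ⟨K, h1, h2, h3⟩ := (((Filter.tendsto_add_atTop_nat 1).eventually
    (opExp_eventually hA (T η))).and (((Filter.tendsto_add_atTop_nat 1).eventually
    (opExp_eventually hA η)).and (opExp_eventually hA η))).exists
  rw [LinearMap.add_apply, LinearMap.smul_apply, Module.End.mul_apply, Module.End.mul_apply, h1]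
  conv_rhs => enter [2]; rw [h3]
  rw [h2]
  rw [Finset.sum_range_succ', Finset.sum_range_succ', map_add, map_sum, Finset.smul_sum,
    add_right_comm, ← Finset.sum_add_distrib]
  congr 1
  · refine Finset.sum_congr rfl fun k _ => ?_
    rw [← Module.End.mul_apply, hpow, LinearMap.add_apply, LinearMap.smul_apply, smul_add,
      map_smul, Module.End.mul_apply, smul_smul, smul_smul, Nat.factorial_succ]
    congr 2
    have h1 : ((k : ℂ) + 1) ≠ 0 := by exact_mod_cast Nat.succ_ne_zero k
    have h2 : (k.factorial : ℂ) ≠ 0 := by exact_mod_cast k.factorial_ne_zero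
    push_cast
    field_simp
  · simp

lemma opExp_of_apply_eq_zero {A : Op} (hA : LocallyNilpotent A) {η : FiniteState} (h : A η = 0) :
    opExp A η = η := by
  obtain ⟨K, h1⟩ := ((Filter.tendsto_add_atTop_nat 1).eventually (opExp_eventually hA η)).exists
  rw [h1, Finset.sum_range_succ']
  simp [pow_succ, h]

/-! ### Exponential sums over occupation numbers -/

/-- The exponential sum over the occupation numbers of finitely many modes. -/
lemma hasSum_exp_prod_of_finset {ι 𝕜 : Type*} [DecidableEq ι] [RCLike 𝕜] (x : ι → 𝕜)
    (S : Finset ι) :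
    HasSum (Set.indicator {c : ι →₀ ℕ | c.support ⊆ S}
      fun c => c.prod fun n k => x n ^ k / (k.factorial : 𝕜)) (NormedSpace.exp (∑ n ∈ S, x n)) := by
  induction S using Finset.induction_on with
  | empty =>
    rw [Finset.sum_empty, NormedSpace.exp_zero]
    have h := hasSum_single (f := Set.indicator {c : ι →₀ ℕ | c.support ⊆ ∅}
      fun c => c.prod fun n k => x n ^ k / (k.factorial : 𝕜)) 0
      (fun c hc => Set.indicator_of_notMem (by simpa using hc) _)
    rwa [Set.indicator_of_mem (by simp), Finsupp.prod_zero_index] at h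
  | insert a S ha ih =>
    have h1 : HasSum (fun k : ℕ => x a ^ k / (k.factorial : 𝕜)) (NormedSpace.exp (x a)) :=
      NormedSpace.expSeries_div_hasSum_exp (x a)
    have hs := summable_mul_of_summable_norm (R := 𝕜) h1.summable.norm ih.summable.norm
    have h2 := h1.mul ih hs
    rw [Finset.sum_insert ha, NormedSpace.exp_add]
    have hinj : Function.Injective fun c : ι →₀ ℕ => (c a, c.erase a) := by
      intro c d h
      simp only [Prod.mk.injEq] at h
      rw [← Finsupp.single_add_erase a c, ← Finsupp.single_add_erase a d, h.1, h.2]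
    rw [← hinj.hasSum_iff] at h2
    · refine h2.congr_fun fun c => ?_
      have h3 : (c.erase a).support ⊆ S ↔ c.support ⊆ insert a S := by
        rw [Finsupp.support_erase, Finset.subset_insert_iff]
      simp only [Function.comp_apply, Set.indicator_apply, Set.mem_ofPred_eq, h3, mul_ite, mul_zero]
      rw [Finsupp.mul_prod_erase' c a (fun n k => x n ^ k / (k.factorial : 𝕜)) (by simp)]
    · rintro ⟨k, c⟩ hc
      by_cases h : c.support ⊆ S
      · refine (hc ⟨c + Finsupp.single a k, ?_⟩).elim
        have h4 : c a = 0 := by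
          by_contra h5
          exact ha (h (Finsupp.mem_support_iff.2 h5))
        simp only [Finsupp.add_apply, h4, Finsupp.single_eq_same, zero_add, Finsupp.erase_add,
          Finsupp.erase_single, add_zero, Finsupp.erase_of_notMem_support (fun h5 => ha (h h5))]
      · simp [Set.indicator, h]

lemma summable_exp_prod {ι : Type*} (x : ι → ℂ) (hx : Summable fun n => ‖x n‖) :
    Summable fun c : ι →₀ ℕ => c.prod fun n k => x n ^ k / (k.factorial : ℂ) := by
  classical
  refine Summable.of_norm (summable_of_sum_le (c := Real.exp (∑' n, ‖x n‖))
    (fun _ => norm_nonneg _) fun u => ?_)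
  have h := hasSum_exp_prod_of_finset (𝕜 := ℝ) (fun n => ‖x n‖) (u.biUnion Finsupp.support)
  have hnn : ∀ c : ι →₀ ℕ, 0 ≤ c.prod fun n k => ‖x n‖ ^ k / (k.factorial : ℝ) := fun c =>
    Finset.prod_nonneg fun n _ => by positivity
  calc ∑ c ∈ u, ‖c.prod fun n k => x n ^ k / (k.factorial : ℂ)‖
      = ∑ c ∈ u, Set.indicator {c : ι →₀ ℕ | c.support ⊆ u.biUnion Finsupp.support}
          (fun c => c.prod fun n k => ‖x n‖ ^ k / (k.factorial : ℝ)) c := by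
        refine Finset.sum_congr rfl fun c hc => ?_
        rw [Set.indicator_of_mem
          (Finset.subset_biUnion_of_mem (Finsupp.support : (ι →₀ ℕ) → _) hc)]
        simp [Finsupp.prod]
    _ ≤ Real.exp (∑ n ∈ u.biUnion Finsupp.support, ‖x n‖) := by
        rw [Real.exp_eq_exp_ℝ]
        exact sum_le_hasSum _ (fun c _ => Set.indicator_nonneg (fun c _ => hnn c) c) h
    _ ≤ _ := Real.exp_le_exp.2 (hx.sum_le_tsum _ fun _ _ => norm_nonneg _)

/-- The sum over all occupation numbers of the product over the modes of exponential series is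
the product of the exponentials. -/
lemma hasSum_exp_prod {ι : Type*} (x : ι → ℂ) (hx : Summable fun n => ‖x n‖) :
    HasSum (fun c : ι →₀ ℕ => c.prod fun n k => x n ^ k / (k.factorial : ℂ))
      (Complex.exp (∑' n, x n)) := by
  classical
  have hs := summable_exp_prod x hx
  have h1 := tendsto_tsum_of_dominated_convergence (𝓕 := Filter.atTop)
    (f := fun (S : Finset ι) => Set.indicator {c : ι →₀ ℕ | c.support ⊆ S}
      fun c => c.prod fun n k => x n ^ k / (k.factorial : ℂ)) hs.norm
    (fun c => by
      refine tendsto_const_nhds.congr' ?_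
      filter_upwards [Filter.eventually_ge_atTop c.support] with S hS
      exact (Set.indicator_of_mem (s := {c : ι →₀ ℕ | c.support ⊆ S}) hS _).symm)
    (Filter.Eventually.of_forall fun S c => norm_indicator_le_norm_self _ _)
  have h2 : Filter.Tendsto (fun S : Finset ι => Complex.exp (∑ n ∈ S, x n)) Filter.atTop
      (nhds (Complex.exp (∑' n, x n))) :=
    (Complex.continuous_exp.tendsto _).comp hx.of_norm.hasSum
  have h3 := tendsto_nhds_unique (h1.congr fun S => by
    rw [(hasSum_exp_prod_of_finset x S).tsum_eq, ← Complex.exp_eq_exp_ℂ]) h2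
  exact h3 ▸ hs.hasSum

/-! ### The inner product and adjoints -/

lemma braket_add_left (η₁ η₂ η' : FiniteState) :
    braket (η₁ + η₂) η' = braket η₁ η' + braket η₂ η' :=
  Finsupp.sum_add_index' (by simp) (by intros; simp [add_mul])

lemma braket_smul_left (a : ℂ) (η η' : FiniteState) :
    braket (a • η) η' = conj a * braket η η' := by
  unfold braket
  rw [Finsupp.sum_smul_index (by simp), Finsupp.mul_sum]
  simp [mul_assoc]

lemma braket_add_right (η η₁ η₂ : FiniteState) :
    braket η (η₁ + η₂) = braket η η₁ + braket η η₂ := by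
  simp [braket, mul_add, Finsupp.sum, Finset.sum_add_distrib]

lemma braket_smul_right (a : ℂ) (η η' : FiniteState) :
    braket η (a • η') = a * braket η η' := by
  simp [braket, Finsupp.sum, Finset.mul_sum, mul_left_comm]

@[simp] lemma braket_zero_left (η' : FiniteState) : braket 0 η' = 0 := Finsupp.sum_zero_index

@[simp] lemma braket_zero_right (η : FiniteState) : braket η 0 = 0 := by
  simp [braket]

lemma braket_ket_left (b : Label) (η : FiniteState) : braket (ket b) η = η b := by
  simp [braket, ket]

/-- Sesquilinear identities need only be checked on kets. -/
lemma braket_apply_congr {S T : Op}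
    (h : ∀ b b', braket (S (ket b)) (ket b') = braket (ket b) (T (ket b'))) (η η' : FiniteState) :
    braket (S η) η' = braket η (T η') := by
  induction η using Finsupp.induction_linear with
  | zero => simp
  | add f g hf hg => simp [braket_add_left, hf, hg]
  | single b a =>
    rw [single_eq_smul_ket, map_smul, braket_smul_left, braket_smul_left]
    congr 1
    induction η' using Finsupp.induction_linear with
    | zero => simp
    | add f g hf hg => simp [braket_add_right, hf, hg]
    | single b' a' => rw [single_eq_smul_ket, map_smul, braket_smul_right, braket_smul_right, h]

lemma braket_ket_ket (b b' : Label) : braket (ket b) (ket b') = if b' = b then 1 else 0 := by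
  rw [braket_ket_left, ket_apply]

lemma label_sub_eq_iff {b b' : Label} {n : ℕ+} (h : b'.2 n ≠ 0) :
    (b'.1, b'.2 - Finsupp.single n 1) = b ↔ b' = (b.1, b.2 + Finsupp.single n 1) := by
  have h1 : Finsupp.single n 1 ≤ b'.2 := by simpa using Nat.one_le_iff_ne_zero.2 h
  rw [Prod.ext_iff, Prod.ext_iff, tsub_eq_iff_eq_add_of_le h1]

lemma braket_create (n : ℕ+) (η η' : FiniteState) :
    braket (create n η) η' = braket η (annihilate n η') := by
  refine braket_apply_congr (fun b b' => ?_) η η'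
  rw [create_ket, annihilate_ket, braket_smul_left, braket_smul_right, braket_ket_ket,
    braket_ket_ket, Complex.conj_ofReal]
  rcases eq_or_ne (b'.2 n) 0 with h | h
  · have : b' ≠ (b.1, b.2 + Finsupp.single n 1) := by
      rintro rfl
      simp at h
    simp [h, this]
  · simp only [label_sub_eq_iff h]
    split_ifs with h1
    · rw [h1]; simp
    · simp

lemma braket_annihilate (n : ℕ+) (η η' : FiniteState) :
    braket (annihilate n η) η' = braket η (create n η') := by
  refine braket_apply_congr (fun b b' => ?_) η η'
  rw [create_ket, annihilate_ket, braket_smul_left, braket_smul_right, braket_ket_ket,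
    braket_ket_ket, Complex.conj_ofReal]
  rcases eq_or_ne (b.2 n) 0 with h | h
  · have : (b'.1, b'.2 + Finsupp.single n 1) ≠ b := by
      rintro rfl
      simp at h
    simp [h, this]
  · simp only [eq_comm (a := b'), label_sub_eq_iff h, eq_comm (b := b)]
    split_ifs with h1
    · rw [h1]; simp
    · simp

lemma braket_charge (η η' : FiniteState) :
    braket (charge η) η' = braket η (charge η') := by
  refine braket_apply_congr (fun b b' => ?_) η η'
  rw [charge_ket, charge_ket, braket_smul_left, braket_smul_right, braket_ket_ket]
  split_ifs with h <;> simp [h]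

/-! ### Normal ordered quadratic forms -/

/-- The intertwining relation `⟨c_{-n} b | A | b'⟩ = ⟨b | A | c_n b'⟩ + αₙ ⟨b | A | b'⟩`, that is
`[c_n, A] = αₙ A`, written out on kets. -/
def CreationRule (α : ℕ+ → ℂ) (A : QForm) : Prop := ∀ (n : ℕ+) (b b' : Label),
  ((√((n : ℝ) * ((b.2 n : ℝ) + 1)) : ℝ) : ℂ) * A (b.1, b.2 + Finsupp.single n 1) b' =
    ((√((n : ℝ) * (b'.2 n : ℝ)) : ℝ) : ℂ) * A b (b'.1, b'.2 - Finsupp.single n 1) + α n * A b b'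

/-- A form proportional, on each charge sector, to the normal ordered exponential
`exp (∑ αₙ c_{-n} / n) R ^ Λ exp (∑ βₙ c_n / n)`, with the factor `C Q` on the sector of charge `Q`.
Instead of by an explicit formula it is characterised by its intertwining relations with the modes
and its expectation values between states without oscillator excitations, which determine it. -/
structure IsVertexForm (Λ : ℤ) (C : ℤ → ℂ) (α β : ℕ+ → ℂ) (A : QForm) : Prop where
  charge_eq : ∀ b b' : Label, b.1 ≠ b'.1 + Λ → A b b' = 0
  vac : ∀ Q : ℤ, A (Q + Λ, 0) (Q, 0) = C Q
  create : CreationRule α A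
  annihilate : CreationRule β fun b b' => A b' b

lemma occupation_induction {P : (ℕ+ →₀ ℕ) → Prop} (h0 : P 0)
    (h : ∀ n m, P m → P (m + Finsupp.single n 1)) (m : ℕ+ →₀ ℕ) : P m := by
  induction m using Finsupp.induction with
  | zero => exact h0
  | single_add a k f _ _ ih =>
    rw [add_comm]
    clear * - h ih
    induction k with
    | zero => simpa using ih
    | succ k hk => rw [Finsupp.single_add, ← add_assoc]; exact h _ _ hk

lemma sqrt_factor_ne_zero (n : ℕ+) (k : ℕ) : ((√((n : ℝ) * ((k : ℝ) + 1)) : ℝ) : ℂ) ≠ 0 := by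
  have : 0 < √((n : ℝ) * ((k : ℝ) + 1)) :=
    Real.sqrt_pos.2 (mul_pos (by exact_mod_cast n.pos) (by positivity))
  exact_mod_cast this.ne'

/-- A creation operator on the left state is moved through `A` and then through `B`. Between them it
acts on the intermediate states, which amounts to a shift of the summation index. -/
lemma CreationRule.mul_hasSum {α α' : ℕ+ → ℂ} {A B : QForm} (hA : CreationRule α A)
    (hB : CreationRule α' B) (n : ℕ+) (b b' : Label)
    (h1 : Summable fun c => A b c * B c b')
    (h2 : Summable fun c => A b c * B c (b'.1, b'.2 - Finsupp.single n 1)) :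
    HasSum (fun c => ((√((n : ℝ) * ((b.2 n : ℝ) + 1)) : ℝ) : ℂ) *
        (A (b.1, b.2 + Finsupp.single n 1) c * B c b'))
      (((√((n : ℝ) * (b'.2 n : ℝ)) : ℝ) : ℂ) *
        (∑' c, A b c * B c (b'.1, b'.2 - Finsupp.single n 1)) +
        (α + α') n * ∑' c, A b c * B c b') := by
  have hinj : Function.Injective fun c : Label => ((c.1, c.2 + Finsupp.single n 1) : Label) := by
    rintro ⟨c1, c2⟩ ⟨d1, d2⟩ h
    simpa using h
  have h3 : HasSum (fun c => ((√((n : ℝ) * (c.2 n : ℝ)) : ℝ) : ℂ) *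
      A b (c.1, c.2 - Finsupp.single n 1) * B c b')
      (((√((n : ℝ) * (b'.2 n : ℝ)) : ℝ) : ℂ) *
        (∑' c, A b c * B c (b'.1, b'.2 - Finsupp.single n 1)) +
        α' n * ∑' c, A b c * B c b') := by
    rw [← hinj.hasSum_iff]
    · refine ((h2.hasSum.mul_left _).add (h1.hasSum.mul_left (α' n))).congr_fun ?_
      intro c
      simp only [Function.comp_apply, Finsupp.add_apply, Finsupp.single_eq_same, Nat.cast_add,
        Nat.cast_one, add_tsub_cancel_right, Prod.mk.eta]
      linear_combination (A b c) * hB n c b'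
    · intro c hc
      have : c.2 n = 0 := by
        by_contra h
        exact hc ⟨(c.1, c.2 - Finsupp.single n 1), ((label_sub_eq_iff h).1 rfl).symm⟩
      simp [this]
  have h4 := h3.add (h1.hasSum.mul_left (α n))
  convert h4 using 1
  · funext c
    linear_combination (B c b') * hA n b c
  · rw [Pi.add_apply]; ring

lemma CreationRule.summable_step {α α' : ℕ+ → ℂ} {A B : QForm} (hA : CreationRule α A)
    (hB : CreationRule α' B) (n : ℕ+) (b b' : Label)
    (h1 : Summable fun c => A b c * B c b')
    (h2 : Summable fun c => A b c * B c (b'.1, b'.2 - Finsupp.single n 1)) :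
    Summable fun c => A (b.1, b.2 + Finsupp.single n 1) c * B c b' :=
  (summable_mul_left_iff (sqrt_factor_ne_zero n (b.2 n))).1 (hA.mul_hasSum hB n b b' h1 h2).summable

lemma CreationRule.prod {α α' : ℕ+ → ℂ} {A B : QForm} (hA : CreationRule α A)
    (hB : CreationRule α' B) (h : QForm.ProdDefined A B) :
    CreationRule (α + α') (QForm.prod A B) := by
  intro n b b'
  rw [QForm.prod, ← tsum_mul_left, (hA.mul_hasSum hB n b b' (h _ _) (h _ _)).tsum_eq]
  rfl

/-- Absolute convergence between charge states propagates to all states, first along the right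
and then along the left label. -/
lemma prodDefined_of_vacuum {α α' β β' : ℕ+ → ℂ} {A B : QForm} (hA : CreationRule α A)
    (hB : CreationRule α' B) (hA' : CreationRule β fun b b' => A b' b)
    (hB' : CreationRule β' fun b b' => B b' b)
    (h : ∀ Q Q', Summable fun c => A (Q, 0) c * B c (Q', 0)) : QForm.ProdDefined A B := by
  have h1 : ∀ m Q Q', Summable fun c => A (Q, 0) c * B c (Q', m) := by
    intro m
    induction m using occupation_induction with
    | h0 => exact h
    | h n m ih =>
      intro Q Q'
      have h2 := hB'.summable_step hA' n (Q', m) (Q, 0) (by simpa only [mul_comm] using ih Q Q')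
        (by simpa only [mul_comm, zero_tsub] using ih Q Q')
      simpa only [mul_comm] using h2
  rintro ⟨Q, m⟩
  induction m using occupation_induction with
  | h0 => rintro ⟨Q', m'⟩; exact h1 m' Q Q'
  | h n m ih => intro b'; exact hA.summable_step hB n (Q, m) b' (ih _) (ih _)

/-- Between charge states the summand is a product over the modes of terms of exponential
series. -/
lemma IsVertexForm.hasSum_vacuum {Λ Λ' : ℤ} {C C' : ℤ → ℂ} {α α' β β' : ℕ+ → ℂ} {A B : QForm}
    (hA : IsVertexForm Λ C α β A) (hB : IsVertexForm Λ' C' α' β' B)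
    (hs : Summable fun n : ℕ+ => ‖β n * α' n / n‖) (Q₁ Q₂ : ℤ) :
    HasSum (fun c => A (Q₁, 0) c * B c (Q₂, 0))
      (A (Q₁, 0) (Q₂ + Λ', 0) * B (Q₂ + Λ', 0) (Q₂, 0) *
        Complex.exp (∑' n : ℕ+, β n * α' n / n)) := by
  have hinj : Function.Injective fun m : ℕ+ →₀ ℕ => ((Q₂ + Λ', m) : Label) :=
    fun _ _ h => (Prod.mk.inj h).2
  rw [← hinj.hasSum_iff]
  · refine ((hasSum_exp_prod _ hs).mul_left _).congr_fun fun m => ?_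
    simp only [Function.comp_apply]
    induction m using occupation_induction with
    | h0 => simp
    | h n m ih =>
      have h1 := hB.create n (Q₂ + Λ', m) (Q₂, 0)
      have h2 := hA.annihilate n (Q₂ + Λ', m) (Q₁, 0)
      have h3 := ofReal_sqrt_mul_self (a := (n : ℝ) * ((m n : ℝ) + 1)) (by positivity)
      have h4 : ((n : ℂ) * (m n + 1)) ≠ 0 := by
        have : (m n : ℂ) + 1 ≠ 0 := Nat.cast_add_one_ne_zero _
        have h5 : (n : ℂ) ≠ 0 := by exact_mod_cast n.ne_zero
        exact mul_ne_zero h5 this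
      have h6 : ∀ x : ℕ+ → ℂ, ((m n : ℂ) + 1) *
          ((m + Finsupp.single n 1).prod fun n k => x n ^ k / (k.factorial : ℂ)) =
          x n * m.prod fun n k => x n ^ k / (k.factorial : ℂ) := by
        intro x
        have h7 := Finsupp.mul_prod_erase' (m + Finsupp.single n 1) n
          (fun n k => x n ^ k / (k.factorial : ℂ)) (by simp)
        have h8 := Finsupp.mul_prod_erase' m n
          (fun n k => x n ^ k / (k.factorial : ℂ)) (by simp)
        rw [← h7, ← h8, Finsupp.erase_add, Finsupp.erase_single, add_zero, Finsupp.add_apply,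
          Finsupp.single_eq_same, Nat.factorial_succ, pow_succ]
        have h9 : (m n : ℂ) + 1 ≠ 0 := Nat.cast_add_one_ne_zero _
        have h10 : ((m n).factorial : ℂ) ≠ 0 := by exact_mod_cast Nat.factorial_ne_zero _
        push_cast
        field_simp
      have h6 := h6 fun n => β n * α' n / n
      simp only [Finsupp.coe_zero, Pi.zero_apply, Nat.cast_zero, mul_zero, Real.sqrt_zero,
        Complex.ofReal_zero, zero_mul, zero_add] at h1 h2
      push_cast at h3
      have h5 : (n : ℂ) ≠ 0 := by exact_mod_cast n.ne_zero
      refine mul_left_cancel₀ h4 ?_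
      set F := (m + Finsupp.single n 1).prod fun n k => (β n * α' n / n) ^ k / (k.factorial : ℂ)
      set G := m.prod fun n k => (β n * α' n / n) ^ k / (k.factorial : ℂ)
      symm
      calc _ = (A (Q₁, 0) (Q₂ + Λ', 0) * B (Q₂ + Λ', 0) (Q₂, 0)) * n * ((m n + 1) * F) := by ring
        _ = (β n * α' n) * ((A (Q₁, 0) (Q₂ + Λ', 0) * B (Q₂ + Λ', 0) (Q₂, 0)) * G) := by
          rw [h6]; field_simp
        _ = (β n * A (Q₁, 0) (Q₂ + Λ', m)) * (α' n * B (Q₂ + Λ', m) (Q₂, 0)) := by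
          rw [← ih]; ring
        _ = _ := by rw [← h1, ← h2, ← h3]; ring
  · intro c hc
    rw [hB.charge_eq, mul_zero]
    rintro h
    exact hc ⟨c.2, by simp only [← h]⟩

/-- Normal ordering of a product: moving `exp (∑ βₙ c_n / n)` to the right of
`exp (∑ α'ₙ c_{-n} / n)` produces the factor `exp (∑ βₙ α'ₙ / n)`. -/
lemma IsVertexForm.prod {Λ Λ' : ℤ} {C C' : ℤ → ℂ} {α α' β β' : ℕ+ → ℂ} {A B : QForm}
    (hA : IsVertexForm Λ C α β A) (hB : IsVertexForm Λ' C' α' β' B)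
    (hs : Summable fun n : ℕ+ => ‖β n * α' n / n‖) :
    QForm.ProdDefined A B ∧ IsVertexForm (Λ + Λ')
      (fun Q => C (Q + Λ') * C' Q * Complex.exp (∑' n : ℕ+, β n * α' n / n)) (α + α') (β + β')
      (QForm.prod A B) := by
  have hdef : QForm.ProdDefined A B := prodDefined_of_vacuum hA.create hB.create hA.annihilate
    hB.annihilate fun Q Q' => (hA.hasSum_vacuum hB hs Q Q').summable
  refine ⟨hdef, ⟨fun b b' h => ?_, fun Q => ?_, hA.create.prod hB.create hdef, ?_⟩⟩
  · rw [QForm.prod, ← tsum_zero (β := Label) (L := .unconditional _)]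
    refine tsum_congr fun c => ?_
    by_cases h1 : b.1 = c.1 + Λ
    · rw [hB.charge_eq c b' (fun h2 => h (by rw [h1, h2]; ring)), mul_zero]
    · rw [hA.charge_eq b c h1, zero_mul]
  · rw [QForm.prod, (hA.hasSum_vacuum hB hs _ _).tsum_eq, hB.vac, ← hA.vac,
      show Q + (Λ + Λ') = Q + Λ' + Λ by ring]
  · have h := hB.annihilate.prod hA.annihilate fun b b' => by
      simpa only [mul_comm] using hdef b' b
    rw [add_comm] at h
    convert h using 3 with b b'
    exact tsum_congr fun c => mul_comm _ _

/-- The form `⟨S b | T b'⟩` obeys the intertwining relations if the operators `S` and `T` obey them. -/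
lemma isVertexForm_braket {Λ : ℤ} {C : ℤ → ℂ} {α β : ℕ+ → ℂ} {S T : Op}
    (hS₀ : S * charge = charge * S)
    (hSa : ∀ n, S * ChiralBoson.annihilate n = ChiralBoson.annihilate n * S)
    (hSc : ∀ n, S * ChiralBoson.create n = ChiralBoson.create n * S + conj (α n) • S)
    (hT₀ : charge * T = T * charge + (Λ : ℂ) • T)
    (hTa : ∀ n, T * ChiralBoson.annihilate n = ChiralBoson.annihilate n * T)
    (hTc : ∀ n, T * ChiralBoson.create n = ChiralBoson.create n * T + β n • T)
    (hvac : ∀ Q : ℤ, braket (S (ket (Q + Λ, 0))) (T (ket (Q, 0))) = C Q) :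
    IsVertexForm Λ C α β fun b b' => braket (S (ket b)) (T (ket b')) := by
  refine ⟨fun b b' h => ?_, hvac, fun n b b' => ?_, fun n b' b => ?_⟩
  · have h1 : braket (S (charge (ket b))) (T (ket b')) =
        braket (S (ket b)) (T (charge (ket b'))) + Λ * braket (S (ket b)) (T (ket b')) := by
      rw [op_apply_comm hS₀, braket_charge, ← Module.End.mul_apply charge, hT₀,
        LinearMap.add_apply, LinearMap.smul_apply, braket_add_right, braket_smul_right,
        Module.End.mul_apply]
    rw [charge_ket, charge_ket, map_smul, map_smul, braket_smul_left, braket_smul_right] at h1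
    have h2 : ((b.1 : ℂ) - (b'.1 + Λ)) * braket (S (ket b)) (T (ket b')) = 0 := by
      rw [map_intCast] at h1
      linear_combination h1
    refine (mul_eq_zero.1 h2).resolve_left fun h3 => h ?_
    exact_mod_cast sub_eq_zero.1 h3
  · have h1 : braket (S (ChiralBoson.create n (ket b))) (T (ket b')) =
        braket (S (ket b)) (T (ChiralBoson.annihilate n (ket b'))) +
          α n * braket (S (ket b)) (T (ket b')) := by
      rw [← Module.End.mul_apply S, hSc, LinearMap.add_apply, LinearMap.smul_apply,
        Module.End.mul_apply, braket_add_left, braket_smul_left, Complex.conj_conj, braket_create,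
        op_apply_comm (hTa n)]
    rw [create_ket, annihilate_ket, map_smul, map_smul, braket_smul_left, braket_smul_right,
      Complex.conj_ofReal] at h1
    exact h1
  · have h1 : braket (S (ket b)) (T (ChiralBoson.create n (ket b'))) =
        braket (S (ChiralBoson.annihilate n (ket b))) (T (ket b')) +
          β n * braket (S (ket b)) (T (ket b')) := by
      rw [← Module.End.mul_apply T, hTc, LinearMap.add_apply, LinearMap.smul_apply,
        Module.End.mul_apply, braket_add_right, braket_smul_right, op_apply_comm (hSa n),
        braket_annihilate]
    rw [create_ket, annihilate_ket, map_smul, map_smul, braket_smul_left, braket_smul_right,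
      Complex.conj_ofReal] at h1
    exact h1

lemma isVertexForm_one : IsVertexForm 0 (fun _ => 1) 0 0 (QForm.ofOp 1) :=
  isVertexForm_braket (S := 1) (T := 1) (by simp) (by simp) (by simp) (by simp) (by simp) (by simp)
    (by simp [braket_ket_ket])

/-! ### Vertex operators -/

lemma raiseCharge_ket (b : Label) : raiseCharge (ket b) = ket (b.1 + 1, b.2) := by
  simp [raiseCharge, ket]
  rfl

lemma raiseCharge_zpow_ket (ℓ : ℤ) (b : Label) :
    (raiseCharge ^ ℓ) (ket b) = ket (b.1 + ℓ, b.2) := by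
  induction ℓ using Int.induction_on generalizing b with
  | zero => simp
  | succ k ih =>
    rw [zpow_add_one, LinearEquiv.mul_apply, raiseCharge_ket, ih]
    simp only [add_assoc, add_comm (1 : ℤ)]
  | pred k ih =>
    rw [zpow_sub_one, LinearEquiv.mul_apply]
    have h : raiseCharge⁻¹ (ket b) = ket (b.1 - 1, b.2) := by
      refine (LinearEquiv.symm_apply_eq raiseCharge).2 ?_
      rw [raiseCharge_ket]
      simp
    rw [h, ih]
    congr 2
    simp only
    ring

lemma chargeState_eq (Q : ℤ) : chargeState Q = ket (Q, 0) := by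
  rw [chargeState, vacuum, raiseCharge_zpow_ket, zero_add]

/-- The zero mode part `e^{-i μ 𝒬 x / 2} R ^ ℓ e^{-i μ 𝒬 x / 2}` of the vertex operator,
`μ = ℓ ν₀`. -/
def zeroModeFactor (ν₀ : ℝ) (ℓ : ℤ) (x : ℂ) : Op :=
  expScaledCharge ν₀ (-Complex.I * ((ℓ * ν₀ : ℝ) : ℂ) * x / 2) *
    (raiseCharge ^ ℓ).toLinearMap * expScaledCharge ν₀ (-Complex.I * ((ℓ * ν₀ : ℝ) : ℂ) * x / 2)

/-- The scalar by which the zero mode part of the vertex operator acts on the charge `Q`. -/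
def zeroModePhase (ν₀ : ℝ) (ℓ : ℤ) (x : ℂ) (Q : ℤ) : ℂ :=
  Complex.exp (-Complex.I * (ℓ * ν₀) * (ν₀ * Q + ℓ * ν₀ / 2) * x)

lemma zeroModeFactor_ket (ν₀ : ℝ) (ℓ : ℤ) (x : ℂ) (b : Label) :
    zeroModeFactor ν₀ ℓ x (ket b) = zeroModePhase ν₀ ℓ x b.1 • ket (b.1 + ℓ, b.2) := by
  rw [zeroModeFactor, Module.End.mul_apply, Module.End.mul_apply, expScaledCharge, opOfBasis_ket,
    map_smul, LinearEquiv.coe_coe, raiseCharge_zpow_ket, map_smul, opOfBasis_ket, smul_smul,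
    ← Complex.exp_add, zeroModePhase]
  congr 2
  push_cast
  ring

lemma vertex_isVertexForm (ν₀ : ℝ) (ℓ : ℤ) (x : ℂ) :
    IsVertexForm ℓ (zeroModePhase ν₀ ℓ x)
      (fun n => (ℓ * ν₀ : ℂ) * Complex.exp (-(Complex.I * n * x)))
      (fun n => -(ℓ * ν₀ : ℂ) * Complex.exp (Complex.I * n * x)) (vertex ν₀ ℓ x) := by
  set γ : ℕ+ → ℂ := fun n =>
    -((ℓ * ν₀ : ℝ) : ℂ) * Complex.exp (Complex.I * (n : ℂ) * x) / (n : ℂ) with hγ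
  set γ' : ℕ+ → ℂ := fun k => -((ℓ * ν₀ : ℝ) : ℂ) *
    conj (Complex.exp (-(Complex.I * (k : ℂ) * x))) / (-(k : ℂ)) with hγ'
  set U := zeroModeFactor ν₀ ℓ x with hU
  have hv : vertex ν₀ ℓ x = fun b b' =>
      braket (opExp (lowering γ') (ket b)) ((U * opExp (lowering γ)) (ket b')) := by
    funext b b'
    simp only [vertex, creationExpAdjoint, annihilationExp, mode_natCast]
    rfl
  have hn : ∀ n : ℕ+, (n : ℂ) ≠ 0 := fun n => by exact_mod_cast n.ne_zero
  have hUk := zeroModeFactor_ket ν₀ ℓ x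
  rw [← hU] at hUk
  rw [hv]
  have h' := lowering_locallyNilpotent γ'
  have h := lowering_locallyNilpotent γ
  refine isVertexForm_braket (opExp_comm h' (lowering_charge γ'))
    (fun n => opExp_comm h' (lowering_annihilate γ' n)) (fun n => ?_) ?_ (fun n => ?_) (fun n => ?_)
    fun Q => ?_
  · rw [opExp_comm_scalar h' (lowering_create γ' n)]
    congr 2
    simp only [hγ']
    rw [map_mul, ← Complex.ofReal_intCast, ← Complex.ofReal_mul, Complex.conj_ofReal]
    field_simp [hn n]
  · rw [mul_assoc, opExp_comm h (lowering_charge γ), ← mul_assoc, ← mul_assoc,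
      ← smul_mul_assoc, ← add_mul]
    congr 1
    refine op_ext fun b => ?_
    simp only [Module.End.mul_apply, charge_ket, map_smul, hUk, LinearMap.add_apply,
      LinearMap.smul_apply, smul_smul, ← add_smul]
    congr 1
    push_cast
    ring
  · rw [mul_assoc, opExp_comm h (lowering_annihilate γ n), ← mul_assoc, ← mul_assoc]
    congr 1
    refine op_ext fun b => ?_
    simp only [Module.End.mul_apply, annihilate_ket, map_smul, hUk, smul_smul, mul_comm]
  · rw [mul_assoc, opExp_comm_scalar h (lowering_create γ n), mul_add, mul_smul_comm, ← mul_assoc,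
      ← mul_assoc]
    congr 2
    · refine op_ext fun b => ?_
      simp only [Module.End.mul_apply, create_ket, map_smul, hUk, smul_smul, mul_comm]
    · simp only [hγ]
      push_cast
      field_simp [hn n]
  · rw [opExp_of_apply_eq_zero h' (lowering_vacuum _ _), Module.End.mul_apply,
      opExp_of_apply_eq_zero h (lowering_vacuum _ _), hUk, braket_smul_right, braket_ket_ket]
    simp

/-! ### Products of vertex operators -/

/-- The power sums `∑ⱼ μⱼ e^{-i n uⱼ}`, `μⱼ = ℓⱼ ν₀`. -/
def powerSum (ν₀ : ℝ) {K : ℕ} (ℓ : Fin K → ℤ) (u : Fin K → ℂ) (n : ℕ+) : ℂ :=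
  ∑ j, (ℓ j * ν₀ : ℂ) * Complex.exp (-(Complex.I * n * u j))

/-- The exponent `log (e^{-i x} - e^{-i y})` of the pair factors, with the branch fixed by writing it
as `-i x + log (1 - e^{i (x - y)})` for `Im x > Im y`. -/
def pairPhase (x y : ℂ) : ℂ :=
  -Complex.I * x + Complex.log (1 - Complex.exp (Complex.I * (x - y)))

/-- The logarithm of the matrix element of a product of vertex operators between charge
states. -/
def anyonPhase (ν₀ : ℝ) {K : ℕ} (ℓ : Fin K → ℤ) (Q : ℤ) (u : Fin K → ℂ) : ℂ :=
  ∑ j, -Complex.I * (ℓ j * ν₀) * (ν₀ * Q + ℓ j * ν₀ / 2) * u j +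
    ∑ j, ∑ k ∈ Finset.Ioi j, (ℓ j * ν₀ : ℂ) * (ℓ k * ν₀) * pairPhase (u j) (u k)

/-- The product of the vertex operators with charges `ℓⱼ` at the positions `uⱼ`. -/
def vertexProduct (ν₀ : ℝ) {K : ℕ} (ℓ : Fin K → ℤ) (u : Fin K → ℂ) : QForm :=
  QForm.listProd (List.ofFn fun j => vertex ν₀ (ℓ j) (u j))

lemma norm_exp_lt_one {x y : ℂ} (h : y.im < x.im) :
    ‖Complex.exp (Complex.I * (x - y))‖ < 1 := by
  rw [Complex.norm_exp, Real.exp_lt_one_iff]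
  simpa using h

lemma hasSum_pow_div_pnat {z : ℂ} (hz : ‖z‖ < 1) :
    HasSum (fun n : ℕ+ => z ^ (n : ℕ) / n) (-Complex.log (1 - z)) := by
  have h := Complex.hasSum_taylorSeries_neg_log hz
  rw [← PNat.coe_injective.hasSum_iff] at h
  · exact h
  · intro n hn
    have : n = 0 := by
      by_contra h0
      exact hn ⟨⟨n, Nat.pos_of_ne_zero h0⟩, rfl⟩
    simp [this]

/-- The contraction of one vertex operator with a product of vertex operators to its right, summed as
a logarithm. -/
lemma hasSum_contraction (ν₀ : ℝ) {K : ℕ} (ℓ : Fin K → ℤ) (u : Fin K → ℂ) (ℓ₀ : ℤ) (x : ℂ)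
    (h : ∀ k, (u k).im < x.im) :
    HasSum (fun n : ℕ+ => -(ℓ₀ * ν₀ : ℂ) * Complex.exp (Complex.I * n * x) * powerSum ν₀ ℓ u n / n)
      (∑ k, (ℓ₀ * ν₀ : ℂ) * (ℓ k * ν₀) * Complex.log (1 - Complex.exp (Complex.I * (x - u k)))) := by
  have h1 : ∀ k ∈ Finset.univ, HasSum (fun n : ℕ+ => -((ℓ₀ * ν₀ : ℂ) * (ℓ k * ν₀)) *
      (Complex.exp (Complex.I * (x - u k)) ^ (n : ℕ) / n))
      (-((ℓ₀ * ν₀ : ℂ) * (ℓ k * ν₀)) *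
        -Complex.log (1 - Complex.exp (Complex.I * (x - u k)))) := fun k _ =>
    (hasSum_pow_div_pnat (norm_exp_lt_one (h k))).mul_left _
  have h2 := hasSum_sum h1
  simp only [neg_mul_neg] at h2
  refine h2.congr_fun fun n => ?_
  rw [powerSum, Finset.mul_sum, Finset.sum_div]
  refine Finset.sum_congr rfl fun k _ => ?_
  rw [← Complex.exp_nat_mul, show (n : ℂ) * (Complex.I * (x - u k)) =
    Complex.I * n * x + -(Complex.I * n * u k) by ring, Complex.exp_add]
  ring

/-- On the domain of decreasing imaginary parts all sums over intermediate states converge, and the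
product of vertex operators is again of normal ordered form. -/
lemma vertexProduct_spec (ν₀ : ℝ) {K : ℕ} (ℓ : Fin K → ℤ) (u : Fin K → ℂ)
    (hu : StrictAnti fun j => (u j).im) :
    QForm.ListProdDefined (List.ofFn fun j => vertex ν₀ (ℓ j) (u j)) ∧
    IsVertexForm (∑ j, ℓ j) (fun Q => Complex.exp (anyonPhase ν₀ ℓ Q u)) (powerSum ν₀ ℓ u)
      (fun n => ∑ j, -(ℓ j * ν₀ : ℂ) * Complex.exp (Complex.I * n * u j))
      (vertexProduct ν₀ ℓ u) := by
  induction K with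
  | zero =>
    simp only [vertexProduct, List.ofFn_zero]
    refine ⟨trivial, ?_⟩
    convert isVertexForm_one using 1
    · simp
    · funext Q
      simp [anyonPhase]
    · funext n
      simp [powerSum]
    · funext n
      simp
    · rfl
  | succ K ih =>
    obtain ⟨h1, h2⟩ := ih (fun j => ℓ j.succ) (fun j => u j.succ)
      fun i j hij => hu (Fin.succ_lt_succ_iff.2 hij)
    have h3 := hasSum_contraction ν₀ (fun j => ℓ j.succ) (fun j => u j.succ) (ℓ 0) (u 0)
      fun k => hu (Fin.succ_pos k)
    obtain ⟨h4, h5⟩ := (vertex_isVertexForm ν₀ (ℓ 0) (u 0)).prod h2 h3.summable.norm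
    simp only [vertexProduct, List.ofFn_succ]
    refine ⟨⟨h1, h4⟩, ?_⟩
    convert h5 using 1
    · rw [Fin.sum_univ_succ]
    · funext Q
      rw [h3.tsum_eq, zeroModePhase, ← Complex.exp_add, ← Complex.exp_add]
      congr 1
      simp only [anyonPhase, Fin.sum_univ_succ, Fin.sum_Ioi_zero, Fin.sum_Ioi_succ, pairPhase,
        mul_add, Finset.sum_add_distrib]
      have h6 : ∑ k : Fin K, (ℓ 0 * ν₀ : ℂ) * (ℓ k.succ * ν₀) * (-Complex.I * u 0) =
          -Complex.I * (ℓ 0 * ν₀) * (ν₀ * ∑ k : Fin K, (ℓ k.succ : ℂ)) * u 0 := by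
        simp only [Finset.mul_sum, Finset.sum_mul]
        exact Finset.sum_congr rfl fun k _ => by ring
      rw [h6]
      push_cast
      ring
    · funext n
      simp [powerSum, Fin.sum_univ_succ]
    · funext n
      rw [Fin.sum_univ_succ]
      rfl
    · rfl

/-! ### Matrix elements with a charge state on the right -/

/-- The linear functional `η ↦ ⟨conj η | A | Q⟩` on finite states. -/
def matrixElement (A : QForm) (Q : ℤ) : FiniteState →ₗ[ℂ] ℂ :=
  Finsupp.linearCombination ℂ fun b => A b (Q, 0)

@[simp] lemma matrixElement_ket (A : QForm) (Q : ℤ) (b : Label) :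
    matrixElement A Q (ket b) = A b (Q, 0) := by
  simp [matrixElement, ket]

/-- The complex conjugate state. -/
def conjState (η : FiniteState) : FiniteState := Finsupp.mapRange conj (map_zero _) η

lemma eval_chargeState (A : QForm) (η : FiniteState) (Q : ℤ) :
    A.eval η (chargeState Q) = matrixElement A Q (conjState η) := by
  rw [chargeState_eq, QForm.eval, matrixElement, conjState, Finsupp.linearCombination_apply,
    Finsupp.sum_mapRange_index (by simp)]
  refine Finsupp.sum_congr fun b _ => ?_
  simp [ket]

lemma CreationRule.matrixElement_create {α : ℕ+ → ℂ} {A : QForm} (hA : CreationRule α A)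
    (Q : ℤ) (n : ℕ+) (η : FiniteState) :
    matrixElement A Q (create n η) = α n * matrixElement A Q η := by
  induction η using Finsupp.induction_linear with
  | zero => simp
  | add f g hf hg => simp only [map_add, hf, hg, mul_add]
  | single b a =>
    have h := hA n b (Q, 0)
    simp only [Finsupp.coe_zero, Pi.zero_apply, Nat.cast_zero, mul_zero, Real.sqrt_zero,
      Complex.ofReal_zero, zero_mul, zero_add] at h
    rw [single_eq_smul_ket, map_smul, map_smul, map_smul, create_ket, map_smul, matrixElement_ket,
      matrixElement_ket, smul_eq_mul (b := A _ _), h, smul_eq_mul, smul_eq_mul]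
    ring

/-! ### Derivatives of matrix elements -/

lemma ket_add_single (q : ℤ) (m : ℕ+ →₀ ℕ) (n : ℕ+) : ket (q, m + Finsupp.single n 1) =
    ((√((n : ℝ) * ((m n : ℝ) + 1)) : ℝ) : ℂ)⁻¹ • create n (ket (q, m)) := by
  rw [create_ket, inv_smul_smul₀ (sqrt_factor_ne_zero n (m n))]

/-- A family of functionals on which the creation operators `c_{-n}` act as multiplication by
differentiable functions `αₙ` depends differentiably on the parameter; the annihilation operators act
as the derivatives `n ∂ / ∂αₙ`. -/
lemma hasDerivAt_functional {Ψ : ℂ → FiniteState →ₗ[ℂ] ℂ} {α : ℂ → ℕ+ → ℂ} {γ : ℕ+ → ℂ} {κ t₀ : ℂ}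
    (hc : ∀ᶠ t in nhds t₀, ∀ n η, Ψ t (create n η) = α t n * Ψ t η)
    (hα : ∀ n, HasDerivAt (fun t => α t n) (γ n * n) t₀)
    (h₀ : ∀ q : ℤ, HasDerivAt (fun t => Ψ t (ket (q, 0))) (κ * Ψ t₀ (ket (q, 0))) t₀)
    (η : FiniteState) :
    HasDerivAt (fun t => Ψ t η) (κ * Ψ t₀ η + Ψ t₀ (lowering γ η)) t₀ := by
  induction η using Finsupp.induction_linear with
  | zero => simpa using hasDerivAt_const t₀ (0 : ℂ)
  | add f g hf hg =>
    simp only [map_add]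
    exact (hf.fun_add hg).congr_deriv (by ring)
  | single b a =>
    obtain ⟨q, m⟩ := b
    simp only [single_eq_smul_ket, map_smul, smul_eq_mul]
    suffices h : HasDerivAt (fun t => Ψ t (ket (q, m)))
        (κ * Ψ t₀ (ket (q, m)) + Ψ t₀ (lowering γ (ket (q, m)))) t₀ by
      exact (h.const_mul a).congr_deriv (by ring)
    induction m using occupation_induction with
    | h0 => simpa [lowering_vacuum] using h₀ q
    | h n m ih =>
      rw [ket_add_single]
      simp only [map_smul, smul_eq_mul]
      set s := ((√((n : ℝ) * ((m n : ℝ) + 1)) : ℝ) : ℂ)⁻¹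
      rw [← Module.End.mul_apply (lowering γ), lowering_create, LinearMap.add_apply,
        LinearMap.smul_apply, Module.End.mul_apply, map_add, map_smul, hc.self_of_nhds,
        hc.self_of_nhds]
      refine HasDerivAt.congr_of_eventuallyEq (f₁ := fun t => s * Ψ t (create n (ket (q, m))))
        (f := fun t => s * (α t n * Ψ t (ket (q, m)))) ?_ ?_
      · refine (((hα n).fun_mul ih).const_mul s).congr_deriv ?_
        simp only [Module.End.one_apply, smul_eq_mul]
        ring
      · filter_upwards [hc] with t ht
        rw [ht]

lemma hasDerivAt_functional_lowering {Ψ : ℂ → FiniteState →ₗ[ℂ] ℂ} {γ : ℂ → ℕ+ → ℂ}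
    {γ' : ℕ+ → ℂ} {Ψ' : FiniteState → ℂ} {t₀ : ℂ}
    (hΨ : ∀ η, HasDerivAt (fun t => Ψ t η) (Ψ' η) t₀)
    (hγ : ∀ n, HasDerivAt (fun t => γ t n) (γ' n) t₀) (η : FiniteState) :
    HasDerivAt (fun t => Ψ t (lowering (γ t) η))
      (Ψ' (lowering (γ t₀) η) + Ψ t₀ (lowering γ' η)) t₀ := by
  have hadd : ∀ f g, Ψ' (f + g) = Ψ' f + Ψ' g := fun f g =>
    (hΨ (f + g)).unique (by simpa using (hΨ f).fun_add (hΨ g))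
  have hsmul : ∀ (a : ℂ) f, Ψ' (a • f) = a * Ψ' f := fun a f =>
    (hΨ (a • f)).unique (by simpa using (hΨ f).const_mul a)
  let L : FiniteState →ₗ[ℂ] ℂ := { toFun := Ψ', map_add' := hadd, map_smul' := hsmul }
  have hL : ∀ f, Ψ' f = L f := fun _ => rfl
  simp only [hL] at hΨ ⊢
  induction η using Finsupp.induction_linear with
  | zero => simpa using hasDerivAt_const t₀ (0 : ℂ)
  | add f g hf hg =>
    simp only [map_add]
    exact (hf.fun_add hg).congr_deriv (by ring)
  | single b a =>
    simp only [single_eq_smul_ket, map_smul, smul_eq_mul, lowering_ket _ b _ subset_rfl, map_sum]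
    have h : HasDerivAt (fun t => ∑ n ∈ b.2.support, γ t n * Ψ t (annihilate n (ket b)))
        (∑ n ∈ b.2.support, (γ' n * Ψ t₀ (annihilate n (ket b)) +
          γ t₀ n * L (annihilate n (ket b)))) t₀ :=
      HasDerivAt.fun_sum fun n _ => (hγ n).fun_mul (hΨ _)
    refine (h.const_mul a).congr_deriv ?_
    rw [Finset.sum_add_distrib]
    ring

/-- Holomorphy between charge states propagates to all states. -/
lemma differentiableOn_functional {E : Type*} [NormedAddCommGroup E] [NormedSpace ℂ E] {D : Set E}
    {Ψ : E → FiniteState →ₗ[ℂ] ℂ} {α : E → ℕ+ → ℂ}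
    (hc : ∀ p ∈ D, ∀ n η, Ψ p (create n η) = α p n * Ψ p η)
    (hα : ∀ n, DifferentiableOn ℂ (fun p => α p n) D)
    (h₀ : ∀ q : ℤ, DifferentiableOn ℂ (fun p => Ψ p (ket (q, 0))) D) (η : FiniteState) :
    DifferentiableOn ℂ (fun p => Ψ p η) D := by
  induction η using Finsupp.induction_linear with
  | zero => simp
  | add f g hf hg => simpa only [map_add] using hf.fun_add hg
  | single b a =>
    obtain ⟨q, m⟩ := b
    simp only [single_eq_smul_ket, map_smul, smul_eq_mul]
    refine DifferentiableOn.const_mul ?_ a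
    induction m using occupation_induction with
    | h0 => exact h₀ q
    | h n m ih =>
      rw [ket_add_single]
      simp only [map_smul, smul_eq_mul]
      exact DifferentiableOn.const_mul (((hα n).fun_mul ih).congr fun p hp => hc p hp _ _) _

/-! ### Dependence on the positions -/

/-- The weights `w_{jk} = z_j / (z_j - z_k)` with `z_j = e^{-i u_j}`. The convention `w_{jj} = 1 / 2`
keeps the relation `w_{jk} + w_{kj} = 1` valid on the diagonal. -/
def pairWeight {K : ℕ} (u : Fin K → ℂ) (j k : Fin K) : ℂ :=
  if j = k then 1 / 2 else 1 / (1 - Complex.exp (Complex.I * (u j - u k)))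

/-- The logarithmic derivative `(i / μⱼ) ∂ⱼ` of the matrix element between charge
states. -/
def localMomentum (ν₀ : ℝ) {K : ℕ} (ℓ : Fin K → ℤ) (Q : ℤ) (u : Fin K → ℂ) (j : Fin K) : ℂ :=
  ν₀ * Q + ∑ k, (ℓ k * ν₀) * pairWeight u j k

/-- The functional `η ↦ ⟨conj η | φ(u₁) ⋯ φ(u_K) | Q⟩`. -/
def vertexFunctional (ν₀ : ℝ) {K : ℕ} (ℓ : Fin K → ℤ) (Q : ℤ) (u : Fin K → ℂ) :
    FiniteState →ₗ[ℂ] ℂ :=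
  matrixElement (vertexProduct ν₀ ℓ u) Q

/-- The operator `∑ₙ z ^ n c_n` with `z = e^{-i t}`. -/
def modeField (t : ℂ) : Op := lowering fun n => Complex.exp (-(Complex.I * n * t))

lemma isOpen_strictAnti_im (K : ℕ) : IsOpen {u : Fin K → ℂ | StrictAnti fun j => (u j).im} := by
  have h : {u : Fin K → ℂ | StrictAnti fun j => (u j).im} =
      ⋂ i : Fin K, ⋂ j : Fin K, {u | i < j → (u j).im < (u i).im} := by
    ext u
    simp [StrictAnti]
  rw [h]
  refine isOpen_iInter_of_finite fun i => isOpen_iInter_of_finite fun j => ?_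
  by_cases hij : i < j
  · simp only [hij, forall_const]
    exact isOpen_lt (by fun_prop) (by fun_prop)
  · simp [hij]

lemma lowering_const_mul (a : ℂ) (γ : ℕ+ → ℂ) :
    lowering (fun n => a * γ n) = a • lowering γ := by
  refine op_ext fun b => ?_
  rw [LinearMap.smul_apply, lowering_ket _ b _ subset_rfl, lowering_ket _ b _ subset_rfl,
    Finset.smul_sum]
  simp only [smul_smul]

lemma one_sub_mem_slitPlane {x y : ℂ} (h : y.im < x.im) :
    1 - Complex.exp (Complex.I * (x - y)) ∈ Complex.slitPlane := by
  rw [sub_eq_add_neg]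
  exact Complex.mem_slitPlane_of_norm_lt_one (by simpa using norm_exp_lt_one h)

lemma exp_ne_one_of_im_ne {x y : ℂ} (h : x.im ≠ y.im) :
    Complex.exp (Complex.I * (x - y)) ≠ 1 := by
  intro h1
  have h2 := congrArg (fun z : ℂ => ‖z‖) h1
  simp only [Complex.norm_exp, norm_one, Real.exp_eq_one_iff] at h2
  simp only [Complex.mul_re, Complex.I_re, Complex.sub_re, zero_mul, Complex.I_im, Complex.sub_im,
    one_mul, zero_sub, neg_eq_zero] at h2
  exact h (sub_eq_zero.1 h2)

lemma exp_swap (x y : ℂ) : Complex.exp (Complex.I * (y - x)) =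
    (Complex.exp (Complex.I * (x - y)))⁻¹ := by
  rw [← Complex.exp_neg]
  ring_nf

lemma one_div_one_sub_inv {e : ℂ} (h0 : e ≠ 0) (h1 : e ≠ 1) : 1 / (1 - e⁻¹) = -(e / (1 - e)) := by
  have h2 : 1 - e ≠ 0 := sub_ne_zero.2 h1.symm
  have h3 : e - 1 ≠ 0 := sub_ne_zero.2 h1
  have h4 : 1 - e⁻¹ ≠ 0 := sub_ne_zero.2 fun h => h1 (inv_eq_one.1 h.symm)
  field_simp
  ring

lemma hasDerivAt_pairPhase {x y : ℂ → ℂ} {x' y' t : ℂ} (hx : HasDerivAt x x' t)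
    (hy : HasDerivAt y y' t) (h : (y t).im < (x t).im) :
    HasDerivAt (fun t => pairPhase (x t) (y t))
      (-Complex.I * (1 / (1 - Complex.exp (Complex.I * (x t - y t))) * x' +
        1 / (1 - Complex.exp (Complex.I * (y t - x t))) * y')) t := by
  have h1 := (((hx.fun_sub hy).const_mul Complex.I).cexp.const_sub 1).clog
    (one_sub_mem_slitPlane h)
  refine ((hx.const_mul (-Complex.I)).fun_add h1).congr_deriv ?_
  rw [exp_swap (x t)]
  have h2 := exp_ne_one_of_im_ne h.ne'
  have h3 := Complex.exp_ne_zero (Complex.I * (x t - y t))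
  set e := Complex.exp (Complex.I * (x t - y t))
  have h4 : 1 - e ≠ 0 := sub_ne_zero.2 h2.symm
  rw [one_div_one_sub_inv h3 h2]
  field_simp
  ring

lemma sum_Ioi_add_swap {K : ℕ} (f : Fin K → Fin K → ℂ) :
    ∑ a, ∑ b ∈ Finset.Ioi a, (f a b + f b a) = ∑ a, ∑ b, f a b - ∑ a, f a a := by
  have h := Finset.sum_sum_Ioi_add_eq_sum_sum_off_diag fun a b => f b a
  rw [h, ← Finset.sum_sub_distrib]
  refine Finset.sum_congr rfl fun a _ => ?_
  rw [← Finset.sum_compl_add_sum {a} (fun b => f a b), Finset.sum_singleton, add_sub_cancel_right]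

lemma hasDerivAt_anyonPhase (ν₀ : ℝ) {K : ℕ} (ℓ : Fin K → ℤ) (Q : ℤ) {u : Fin K → ℂ}
    (hu : StrictAnti fun j => (u j).im) (j : Fin K) :
    HasDerivAt (fun t => anyonPhase ν₀ ℓ Q (Function.update u j t))
      (-Complex.I * (ℓ j * ν₀) * localMomentum ν₀ ℓ Q u j) (u j) := by
  set d : Fin K → ℂ := Pi.single j 1 with hd
  have h1 : ∀ a, HasDerivAt (fun t => Function.update u j t a) (d a) (u j) :=
    hasDerivAt_pi.1 (hasDerivAt_update u j (u j))
  have h2 : HasDerivAt (fun t => anyonPhase ν₀ ℓ Q (Function.update u j t))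
      (∑ a, -Complex.I * (ℓ a * ν₀) * (ν₀ * Q + ℓ a * ν₀ / 2) * d a +
        ∑ a, ∑ b ∈ Finset.Ioi a, (ℓ a * ν₀ : ℂ) * (ℓ b * ν₀) *
          (-Complex.I * (1 / (1 - Complex.exp (Complex.I * (u a - u b))) * d a +
            1 / (1 - Complex.exp (Complex.I * (u b - u a))) * d b))) (u j) := by
    refine HasDerivAt.fun_add (HasDerivAt.fun_sum fun a _ => (h1 a).const_mul _)
      (HasDerivAt.fun_sum fun a _ => HasDerivAt.fun_sum fun b hb => HasDerivAt.const_mul _ ?_)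
    have h3 := hasDerivAt_pairPhase (h1 a) (h1 b)
      (by simpa using hu (Finset.mem_Ioi.1 hb))
    simpa only [Function.update_eq_self] using h3
  refine h2.congr_deriv ?_
  have h4 : ∀ a, ∀ b ∈ Finset.Ioi a, (ℓ a * ν₀ : ℂ) * (ℓ b * ν₀) *
      (-Complex.I * (1 / (1 - Complex.exp (Complex.I * (u a - u b))) * d a +
        1 / (1 - Complex.exp (Complex.I * (u b - u a))) * d b)) =
      -Complex.I * ((ℓ a * ν₀ : ℂ) * (ℓ b * ν₀) * pairWeight u a b * d a) +
      -Complex.I * ((ℓ b * ν₀ : ℂ) * (ℓ a * ν₀) * pairWeight u b a * d b) := by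
    intro a b hb
    have hab : a ≠ b := (Finset.mem_Ioi.1 hb).ne
    rw [pairWeight, pairWeight, if_neg hab, if_neg hab.symm]
    ring
  rw [Finset.sum_congr rfl fun a _ => Finset.sum_congr rfl (h4 a),
    sum_Ioi_add_swap fun a b => -Complex.I * ((ℓ a * ν₀ : ℂ) * (ℓ b * ν₀) * pairWeight u a b * d a),
    ← Finset.sum_sub_distrib, ← Finset.sum_add_distrib, Finset.sum_eq_single j]
  · simp only [hd, Pi.single_eq_same, localMomentum, pairWeight, mul_add, Finset.mul_sum, if_true]
    simp only [mul_one, ← mul_assoc]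
    ring
  · intro a _ ha
    simp [hd, Pi.single_eq_of_ne ha]
  · simp

lemma vertexFunctional_create (ν₀ : ℝ) {K : ℕ} (ℓ : Fin K → ℤ) (Q : ℤ) {u : Fin K → ℂ}
    (hu : StrictAnti fun j => (u j).im) (n : ℕ+) (η : FiniteState) :
    vertexFunctional ν₀ ℓ Q u (create n η) = powerSum ν₀ ℓ u n * vertexFunctional ν₀ ℓ Q u η :=
  (vertexProduct_spec ν₀ ℓ u hu).2.create.matrixElement_create Q n η

lemma vertexFunctional_vacuum (ν₀ : ℝ) {K : ℕ} (ℓ : Fin K → ℤ) (Q : ℤ) {u : Fin K → ℂ}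
    (hu : StrictAnti fun j => (u j).im) (q : ℤ) :
    vertexFunctional ν₀ ℓ Q u (ket (q, 0)) =
      (if q = Q + ∑ j, ℓ j then 1 else 0) * Complex.exp (anyonPhase ν₀ ℓ Q u) := by
  rw [vertexFunctional, matrixElement_ket]
  split_ifs with h
  · rw [h, (vertexProduct_spec ν₀ ℓ u hu).2.vac, one_mul]
  · rw [(vertexProduct_spec ν₀ ℓ u hu).2.charge_eq _ _ h, zero_mul]

lemma eventually_strictAnti_update {K : ℕ} {u : Fin K → ℂ} (hu : StrictAnti fun j => (u j).im)
    (j : Fin K) : ∀ᶠ t in nhds (u j), StrictAnti fun i => (Function.update u j t i).im := by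
  have h : Continuous fun t => Function.update u j t := by fun_prop
  refine h.continuousAt.eventually ((isOpen_strictAnti_im K).mem_nhds ?_)
  simpa using hu

lemma hasDerivAt_vertexFunctional (ν₀ : ℝ) {K : ℕ} (ℓ : Fin K → ℤ) (Q : ℤ) {u : Fin K → ℂ}
    (hu : StrictAnti fun j => (u j).im) (j : Fin K) (η : FiniteState) :
    HasDerivAt (fun t => vertexFunctional ν₀ ℓ Q (Function.update u j t) η)
      (-Complex.I * (ℓ j * ν₀) * (localMomentum ν₀ ℓ Q u j * vertexFunctional ν₀ ℓ Q u η +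
        vertexFunctional ν₀ ℓ Q u (modeField (u j) η))) (u j) := by
  have hev := eventually_strictAnti_update hu j
  have h := hasDerivAt_functional
    (Ψ := fun t => vertexFunctional ν₀ ℓ Q (Function.update u j t))
    (α := fun t => powerSum ν₀ ℓ (Function.update u j t))
    (γ := fun n => (-Complex.I * (ℓ j * ν₀)) * Complex.exp (-(Complex.I * n * u j)))
    (κ := -Complex.I * (ℓ j * ν₀) * localMomentum ν₀ ℓ Q u j) (t₀ := u j)
    (by filter_upwards [hev] with t ht using vertexFunctional_create ν₀ ℓ Q ht) ?_ ?_ η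
  · rw [lowering_const_mul, Function.update_eq_self, LinearMap.smul_apply, map_smul,
      smul_eq_mul] at h
    refine h.congr_deriv ?_
    rw [modeField]
    ring
  · intro n
    have h1 : ∀ a, HasDerivAt (fun t => Function.update u j t a) ((Pi.single j 1 : Fin K → ℂ) a)
        (u j) := hasDerivAt_pi.1 (hasDerivAt_update u j (u j))
    have h2 : HasDerivAt (fun t => powerSum ν₀ ℓ (Function.update u j t) n)
        (∑ a, (ℓ a * ν₀ : ℂ) * (Complex.exp (-(Complex.I * n * Function.update u j (u j) a)) *
          -(Complex.I * n * (Pi.single j 1 : Fin K → ℂ) a))) (u j) :=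
      HasDerivAt.fun_sum fun a _ => ((h1 a).const_mul (Complex.I * n)).fun_neg.cexp.const_mul _
    refine h2.congr_deriv ?_
    rw [Finset.sum_eq_single j]
    · simp only [Function.update_eq_self, Pi.single_eq_same]
      ring
    · intro a _ ha
      simp [Pi.single_eq_of_ne ha]
    · simp
  · intro q
    simp only [Function.update_eq_self]
    rw [vertexFunctional_vacuum ν₀ ℓ Q hu]
    have h1 := ((hasDerivAt_anyonPhase ν₀ ℓ Q hu j).cexp.const_mul
      (if q = Q + ∑ j, ℓ j then 1 else 0))
    refine (h1.congr_of_eventuallyEq ?_).congr_deriv ?_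
    · filter_upwards [hev] with t ht using vertexFunctional_vacuum ν₀ ℓ Q ht q
    · simp only [Function.update_eq_self]
      ring

lemma hasDerivAt_localMomentum (ν₀ : ℝ) {K : ℕ} (ℓ : Fin K → ℤ) (Q : ℤ) {u : Fin K → ℂ}
    (hu : StrictAnti fun j => (u j).im) (j : Fin K) :
    HasDerivAt (fun t => localMomentum ν₀ ℓ Q (Function.update u j t) j)
      (-Complex.I * (∑ k, (ℓ k * ν₀) * (pairWeight u j k * pairWeight u k j) - ℓ j * ν₀ / 4))
      (u j) := by
  have h1 : ∀ k, HasDerivAt (fun t => pairWeight (Function.update u j t) j k)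
      (-Complex.I * (pairWeight u j k * pairWeight u k j - if k = j then 1 / 4 else 0)) (u j) := by
    intro k
    rcases eq_or_ne k j with rfl | hk
    · simp only [pairWeight, if_true]
      refine (hasDerivAt_const (u k) (1 / 2 : ℂ)).congr_deriv ?_
      norm_num
    · simp only [pairWeight, if_neg hk.symm, if_neg hk, Function.update_self,
        Function.update_of_ne hk]
      have h2 : Complex.exp (Complex.I * (u j - u k)) ≠ 1 :=
        exp_ne_one_of_im_ne fun h => hk.symm (hu.injective h)
      have h4 : 1 - Complex.exp (Complex.I * (u j - u k)) ≠ 0 := sub_ne_zero.2 h2.symm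
      have h3 := ((((hasDerivAt_id (u j)).sub_const (u k)).const_mul Complex.I).cexp.const_sub
        1).fun_inv h4
      simp only [one_div]
      refine h3.congr_deriv ?_
      simp only [id]
      rw [exp_swap (u j) (u k)]
      have h0 := Complex.exp_ne_zero (Complex.I * (u j - u k))
      set e := Complex.exp (Complex.I * (u j - u k))
      rw [← one_div (1 - e⁻¹), one_div_one_sub_inv h0 h2]
      field_simp
      ring
  have h2 : HasDerivAt (fun t => localMomentum ν₀ ℓ Q (Function.update u j t) j)
      (∑ k, (ℓ k * ν₀ : ℂ) *
        (-Complex.I * (pairWeight u j k * pairWeight u k j - if k = j then 1 / 4 else 0))) (u j) :=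
    (HasDerivAt.fun_sum fun k _ => (h1 k).const_mul _).const_add _
  refine h2.congr_deriv ?_
  simp only [mul_sub, mul_ite, mul_zero, Finset.sum_sub_distrib, Finset.sum_ite_eq',
    Finset.mem_univ, if_true, Finset.mul_sum]
  congr 1
  · exact Finset.sum_congr rfl fun k _ => by ring
  · ring

/-- The operator `∑ₙ n z ^ n c_n` with `z = e^{-i t}`. -/
def modeFieldDeriv (t : ℂ) : Op := lowering fun n => n * Complex.exp (-(Complex.I * n * t))

lemma iteratedDeriv_one_vertexFunctional (ν₀ : ℝ) {K : ℕ} (ℓ : Fin K → ℤ) (Q : ℤ) {u : Fin K → ℂ}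
    (hu : StrictAnti fun j => (u j).im) (j : Fin K) (η : FiniteState) :
    iteratedDeriv 1 (fun t => vertexFunctional ν₀ ℓ Q (Function.update u j t) η) (u j) =
      -Complex.I * (ℓ j * ν₀) * (localMomentum ν₀ ℓ Q u j * vertexFunctional ν₀ ℓ Q u η +
        vertexFunctional ν₀ ℓ Q u (modeField (u j) η)) := by
  rw [iteratedDeriv_one, (hasDerivAt_vertexFunctional ν₀ ℓ Q hu j η).deriv]

lemma iteratedDeriv_two_vertexFunctional (ν₀ : ℝ) {K : ℕ} (ℓ : Fin K → ℤ) (Q : ℤ) {u : Fin K → ℂ}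
    (hu : StrictAnti fun j => (u j).im) (j : Fin K) (η : FiniteState) :
    iteratedDeriv 2 (fun t => vertexFunctional ν₀ ℓ Q (Function.update u j t) η) (u j) =
      -(ℓ j * ν₀) *
        ((∑ k, (ℓ k * ν₀) * (pairWeight u j k * pairWeight u k j) - ℓ j * ν₀ / 4) *
            vertexFunctional ν₀ ℓ Q u η +
          vertexFunctional ν₀ ℓ Q u (modeFieldDeriv (u j) η) +
          ℓ j * ν₀ * (localMomentum ν₀ ℓ Q u j ^ 2 * vertexFunctional ν₀ ℓ Q u η +
            2 * localMomentum ν₀ ℓ Q u j * vertexFunctional ν₀ ℓ Q u (modeField (u j) η) +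
            vertexFunctional ν₀ ℓ Q u (modeField (u j) (modeField (u j) η)))) := by
  have h1 : deriv (fun t => vertexFunctional ν₀ ℓ Q (Function.update u j t) η) =ᶠ[nhds (u j)]
      fun t => -Complex.I * (ℓ j * ν₀) * (localMomentum ν₀ ℓ Q (Function.update u j t) j *
        vertexFunctional ν₀ ℓ Q (Function.update u j t) η +
        vertexFunctional ν₀ ℓ Q (Function.update u j t) (modeField t η)) := by
    filter_upwards [eventually_strictAnti_update hu j] with t ht
    have h := hasDerivAt_vertexFunctional ν₀ ℓ Q ht j η
    simp only [Function.update_idem, Function.update_self] at h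
    exact h.deriv
  have h2 := hasDerivAt_vertexFunctional ν₀ ℓ Q hu j
  have h3 := hasDerivAt_functional_lowering h2
    (γ := fun t n => Complex.exp (-(Complex.I * n * t)))
    (γ' := fun n => -Complex.I * (n * Complex.exp (-(Complex.I * n * u j)))) (fun n => by
      refine (((hasDerivAt_id (u j)).const_mul (Complex.I * n)).fun_neg.cexp).congr_deriv ?_
      simp only [id]
      ring) η
  rw [lowering_const_mul] at h3
  have h4 := (((hasDerivAt_localMomentum ν₀ ℓ Q hu j).fun_mul (h2 η)).fun_add h3).const_mul
    (-Complex.I * (ℓ j * ν₀))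
  rw [iteratedDeriv_succ, iteratedDeriv_one, h1.deriv_eq]
  refine h4.deriv.trans ?_
  simp only [Function.update_eq_self, LinearMap.smul_apply, map_smul, smul_eq_mul]
  have h5 : lowering (fun n => Complex.exp (-(Complex.I * n * u j))) = modeField (u j) := rfl
  have h6 : lowering (fun n => n * Complex.exp (-(Complex.I * n * u j))) = modeFieldDeriv (u j) :=
    rfl
  rw [h5, h6]
  linear_combination (ℓ j * ν₀ : ℂ) *
        ((∑ k, (ℓ k * ν₀) * (pairWeight u j k * pairWeight u k j) - ℓ j * ν₀ / 4) *
            vertexFunctional ν₀ ℓ Q u η +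
          vertexFunctional ν₀ ℓ Q u (modeFieldDeriv (u j) η) +
          ℓ j * ν₀ * (localMomentum ν₀ ℓ Q u j ^ 2 * vertexFunctional ν₀ ℓ Q u η +
            2 * localMomentum ν₀ ℓ Q u j * vertexFunctional ν₀ ℓ Q u (modeField (u j) η) +
            vertexFunctional ν₀ ℓ Q u (modeField (u j) (modeField (u j) η)))) * Complex.I_mul_I

lemma differentiableOn_vertexFunctional {E : Type*} [NormedAddCommGroup E] [NormedSpace ℂ E]
    {D : Set E} (ν₀ : ℝ) {K : ℕ} (ℓ : Fin K → ℤ) (Q : ℤ) {u : E → Fin K → ℂ}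
    (hu : ∀ j, DifferentiableOn ℂ (fun p => u p j) D)
    (hD : ∀ p ∈ D, StrictAnti fun j => (u p j).im) (η : FiniteState) :
    DifferentiableOn ℂ (fun p => vertexFunctional ν₀ ℓ Q (u p) η) D := by
  refine differentiableOn_functional (α := fun p => powerSum ν₀ ℓ (u p))
    (fun p hp => vertexFunctional_create ν₀ ℓ Q (hD p hp)) (fun n => ?_) (fun q => ?_) η
  · refine DifferentiableOn.fun_sum fun j _ => ?_
    exact (((hu j).const_mul (Complex.I * n)).fun_neg.cexp).const_mul _
  · refine DifferentiableOn.congr ?_ fun p hp => vertexFunctional_vacuum ν₀ ℓ Q (hD p hp) q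
    refine DifferentiableOn.const_mul (DifferentiableOn.cexp ?_) _
    refine DifferentiableOn.fun_add (DifferentiableOn.fun_sum fun j _ => (hu j).const_mul _)
      (DifferentiableOn.fun_sum fun j _ => DifferentiableOn.fun_sum fun k hk =>
        DifferentiableOn.const_mul ?_ _)
    refine DifferentiableOn.fun_add ((hu j).const_mul _) (DifferentiableOn.clog ?_ fun p hp =>
      one_sub_mem_slitPlane (hD p hp (Finset.mem_Ioi.1 hk)))
    exact ((((hu j).fun_sub (hu k)).const_mul _).cexp).const_sub _

/-! ### Transposed operators -/

/-- The bilinear pairing of finite states for which the kets are orthonormal. -/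
def pairing : FiniteState →ₗ[ℂ] FiniteState →ₗ[ℂ] ℂ :=
  Finsupp.linearCombination ℂ fun b => Finsupp.lapply b

lemma pairing_ket_left (b : Label) (η : FiniteState) : pairing (ket b) η = η b := by
  simp [pairing, ket]

lemma pairing_ket_right (η : FiniteState) (c : Label) : pairing η (ket c) = η c := by
  simp only [pairing, ket, Finsupp.linearCombination_apply, Finsupp.sum, LinearMap.coe_sum,
    Finset.sum_apply, LinearMap.smul_apply, Finsupp.lapply_apply, Finsupp.single_apply, smul_eq_mul,
    mul_ite, mul_one, mul_zero, Finset.sum_ite_eq]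
  exact ite_eq_left_iff.2 fun h => (Finsupp.notMem_support_iff.1 h).symm

/-- `T'` is the transpose of `T`: the matrix of `T` in the basis of kets is the transpose of that of
`T'`. -/
def IsTranspose (T T' : Op) : Prop := ∀ η η', pairing (T' η) η' = pairing η (T η')

lemma IsTranspose.apply_ket {T T' : Op} (h : IsTranspose T T') (b c : Label) :
    T (ket c) b = T' (ket b) c := by
  rw [← pairing_ket_left, ← pairing_ket_right, h]

lemma isTranspose_of_ket {T T' : Op} (h : ∀ b c, T (ket c) b = T' (ket b) c) :
    IsTranspose T T' := by
  intro η η'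
  induction η using Finsupp.induction_linear with
  | zero => simp
  | add f g hf hg => simp [hf, hg]
  | single b a =>
    induction η' using Finsupp.induction_linear with
    | zero => simp
    | add f g hf hg => simp [hf, hg]
    | single c a' =>
      simp only [single_eq_smul_ket, map_smul, LinearMap.smul_apply, pairing_ket_left,
        pairing_ket_right, h]

lemma IsTranspose.mul {S S' T T' : Op} (hS : IsTranspose S S') (hT : IsTranspose T T') :
    IsTranspose (S * T) (T' * S') := fun η η' => by
  rw [Module.End.mul_apply, Module.End.mul_apply, hT, hS]

lemma IsTranspose.add {S S' T T' : Op} (hS : IsTranspose S S') (hT : IsTranspose T T') :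
    IsTranspose (S + T) (S' + T') := fun η η' => by
  simp only [LinearMap.add_apply, map_add, hS η η', hT η η']

lemma IsTranspose.smul {T T' : Op} (a : ℂ) (hT : IsTranspose T T') :
    IsTranspose (a • T) (a • T') := fun η η' => by
  simp only [LinearMap.smul_apply, map_smul, hT η η']

lemma isTranspose_of_diagonal {T : Op} (f : Label → ℂ) (h : ∀ b, T (ket b) = f b • ket b) :
    IsTranspose T T := by
  refine isTranspose_of_ket fun b c => ?_
  simp only [h, Finsupp.smul_apply, ket_apply]
  split_ifs with h1 h2 h2
  · rw [h1]
  · exact absurd h1.symm h2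
  · exact absurd h2.symm h1
  · simp

lemma isTranspose_annihilate (n : ℕ+) : IsTranspose (annihilate n) (create n) := by
  refine isTranspose_of_ket fun b c => ?_
  rw [← braket_ket_left, ← braket_create, create_ket, braket_smul_left, braket_ket_left,
    Complex.conj_ofReal]
  simp only [Finsupp.smul_apply, smul_eq_mul, ket_apply]
  simp only [eq_comm]

lemma isTranspose_create (n : ℕ+) : IsTranspose (create n) (annihilate n) :=
  isTranspose_of_ket fun b c => ((isTranspose_annihilate n).apply_ket c b).symm

/-! ### Locally finite sums -/

/-- Only finitely many operators of the family are nonzero on each ket. -/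
def LocallyFiniteFamily {α : Type} (T : α → Op) : Prop :=
  ∀ b, (fun a => T a (ket b)).HasFiniteSupport

lemma locallyFiniteFamily_of_finset {α : Type} {T : α → Op}
    (h : ∀ b, ∃ S : Finset α, ∀ a ∉ S, T a (ket b) = 0) : LocallyFiniteFamily T := by
  intro b
  obtain ⟨S, hS⟩ := h b
  refine S.finite_toSet.subset fun a ha => ?_
  by_contra h
  exact ha (hS a h)

lemma opSum_isTranspose {α : Type} {T T' : α → Op} (hT : LocallyFiniteFamily T)
    (hT' : LocallyFiniteFamily T') (h : ∀ a, IsTranspose (T a) (T' a)) :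
    IsTranspose (opSum T) (opSum T') := by
  refine isTranspose_of_ket fun b c => ?_
  rw [opSum_ket, opSum_ket, ← Finsupp.lapply_apply (R := ℂ), ← Finsupp.lapply_apply (R := ℂ),
    map_finsum _ (hT c), map_finsum _ (hT' b)]
  exact finsum_congr fun a => (h a).apply_ket b c

lemma annihilate_ket_of_notMem {n : ℕ+} {b : Label} (h : n ∉ b.2.support) :
    annihilate n (ket b) = 0 :=
  annihilate_ket_of_eq_zero (Finsupp.notMem_support_iff.1 h)

/-! ### The cubic part of the collective field Hamiltonian -/

/-- The cubic terms with one annihilation operator. -/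
def splitTerm (a : ℕ+ × ℕ+) : Op := create a.1 * create a.2 * annihilate (a.1 + a.2)

/-- The cubic terms with two annihilation operators. -/
def joinTerm (a : ℕ+ × ℕ+) : Op := create (a.1 + a.2) * annihilate a.1 * annihilate a.2

/-- The ordered decompositions `n = a₁ + a₂` of the elements `n` of a finite set. -/
def splittings (S : Finset ℕ+) : Finset (ℕ+ × ℕ+) :=
  (S.sigma fun n => Finset.Iio n).image fun x => (x.2, x.1 - x.2)

lemma mem_splittings {S : Finset ℕ+} {a : ℕ+ × ℕ+} (h : a.1 + a.2 ∈ S) : a ∈ splittings S := by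
  refine Finset.mem_image.2 ⟨⟨a.1 + a.2, a.1⟩, ?_, ?_⟩
  · simpa [h] using PNat.lt_add_right a.1 a.2
  · rw [Prod.ext_iff]
    refine ⟨rfl, ?_⟩
    refine add_left_cancel (a := a.1) ?_
    exact PNat.add_sub_of_lt (PNat.lt_add_right a.1 a.2)

lemma sum_splittings (S : Finset ℕ+) (f : ℕ+ → ℕ+ → ℂ) (g : ℕ+ → ℂ) :
    ∑ a ∈ splittings S, f a.1 a.2 * g (a.1 + a.2) =
      ∑ n ∈ S, (∑ a ∈ Finset.Iio n, f a (n - a)) * g n := by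
  rw [splittings, Finset.sum_image, Finset.sum_sigma]
  · refine Finset.sum_congr rfl fun n _ => ?_
    rw [Finset.sum_mul]
    refine Finset.sum_congr rfl fun a ha => ?_
    simp only [PNat.add_sub_of_lt (Finset.mem_Iio.1 ha)]
  · rintro ⟨n, a⟩ h1 ⟨n', a'⟩ h2 h
    simp only [Prod.mk.injEq] at h
    obtain ⟨rfl, h3⟩ := h
    have h1 : a < n := by simpa using (Finset.mem_sigma.1 h1).2
    have h2 : a < n' := by simpa using (Finset.mem_sigma.1 h2).2
    have h4 : n = n' := by rw [← PNat.add_sub_of_lt h1, h3, PNat.add_sub_of_lt h2]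
    subst h4
    rfl

lemma splitTerm_ket_eq_zero {b : Label} {a : ℕ+ × ℕ+} (h : a ∉ splittings b.2.support) :
    splitTerm a (ket b) = 0 := by
  have h1 : a.1 + a.2 ∉ b.2.support := fun h1 => h (mem_splittings h1)
  simp only [splitTerm, Module.End.mul_apply, annihilate_ket_of_notMem h1, map_zero]

lemma joinTerm_ket_eq_zero {b : Label} {a : ℕ+ × ℕ+}
    (h : a ∉ b.2.support ×ˢ b.2.support) : joinTerm a (ket b) = 0 := by
  rw [Finset.mem_product, not_and_or] at h
  simp only [joinTerm, Module.End.mul_apply]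
  rcases h with h | h
  · rw [op_apply_comm (annihilate_comm _ _), annihilate_ket_of_notMem h, map_zero, map_zero]
  · rw [annihilate_ket_of_notMem h, map_zero, map_zero]

lemma locallyFinite_splitTerm : LocallyFiniteFamily splitTerm :=
  locallyFiniteFamily_of_finset fun _ => ⟨_, fun _ => splitTerm_ket_eq_zero⟩

lemma locallyFinite_joinTerm : LocallyFiniteFamily joinTerm :=
  locallyFiniteFamily_of_finset fun _ => ⟨_, fun _ => joinTerm_ket_eq_zero⟩

lemma isTranspose_splitTerm (a : ℕ+ × ℕ+) : IsTranspose (splitTerm a) (joinTerm a) := by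
  have h := ((isTranspose_create a.1).mul (isTranspose_create a.2)).mul
    (isTranspose_annihilate (a.1 + a.2))
  rwa [annihilate_comm, ← mul_assoc] at h

/-- The six families of zero-sum triples: the position of the entry of largest absolute value, the
sign of the other two entries (`true` for positive), and their absolute values. -/
def tripleEntries : (Fin 3 × Bool) × (ℕ+ × ℕ+) → ℤ × ℤ × ℤ
  | ((0, false), (a, b)) => (-(a : ℕ), -(b : ℕ), (a : ℕ) + (b : ℕ))
  | ((1, false), (a, b)) => (-(a : ℕ), (a : ℕ) + (b : ℕ), -(b : ℕ))
  | ((2, false), (a, b)) => ((a : ℕ) + (b : ℕ), -(a : ℕ), -(b : ℕ))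
  | ((0, true), (a, b)) => ((a : ℕ), (b : ℕ), -((a : ℕ) + (b : ℕ)))
  | ((1, true), (a, b)) => ((a : ℕ), -((a : ℕ) + (b : ℕ)), (b : ℕ))
  | ((2, true), (a, b)) => (-((a : ℕ) + (b : ℕ)), (a : ℕ), (b : ℕ))

lemma tripleEntries_mem (x : (Fin 3 × Bool) × (ℕ+ × ℕ+)) :
    (tripleEntries x).1 ≠ 0 ∧ (tripleEntries x).2.1 ≠ 0 ∧ (tripleEntries x).2.2 ≠ 0 ∧
      (tripleEntries x).1 + (tripleEntries x).2.1 + (tripleEntries x).2.2 = 0 := by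
  obtain ⟨⟨i, s⟩, ⟨a, b⟩⟩ := x
  have ha := a.pos
  have hb := b.pos
  fin_cases i <;> cases s <;> simp only [tripleEntries] <;> refine ⟨?_, ?_, ?_, ?_⟩ <;> omega

/-- The parametrization of the zero-sum triples by the six families. -/
def tripleMap (x : (Fin 3 × Bool) × (ℕ+ × ℕ+)) : ZeroSumTriple :=
  ⟨tripleEntries x, tripleEntries_mem x⟩

lemma tripleMap_injective : Function.Injective tripleMap := by
  rintro ⟨⟨i, s⟩, ⟨a, b⟩⟩ ⟨⟨i', s'⟩, ⟨a', b'⟩⟩ h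
  have h1 : tripleEntries ((i, s), (a, b)) = tripleEntries ((i', s'), (a', b')) :=
    congrArg Subtype.val h
  have ha := a.pos
  have hb := b.pos
  have ha' := a'.pos
  have hb' := b'.pos
  have key : i = i' ∧ s = s' ∧ (a : ℕ) = a' ∧ (b : ℕ) = b' := by
    clear h
    fin_cases i <;> fin_cases i' <;> cases s <;> cases s' <;>
      simp only [tripleEntries, Prod.mk.injEq] at h1 <;>
      first
        | (exfalso; omega)
        | (refine ⟨rfl, rfl, ?_, ?_⟩ <;> omega)
  obtain ⟨rfl, rfl, h2, h3⟩ := key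
  rw [PNat.coe_inj] at h2 h3
  rw [h2, h3]

lemma tripleMap_surjective : Function.Surjective tripleMap := by
  have pos : ∀ n : ℤ, 0 < n → ∃ a : ℕ+, n = (a : ℕ) := fun n hn =>
    ⟨⟨n.toNat, by omega⟩, by simp only [PNat.mk_coe]; omega⟩
  have neg : ∀ n : ℤ, n < 0 → ∃ a : ℕ+, n = -(a : ℕ) := fun n hn => by
    obtain ⟨a, ha⟩ := pos (-n) (by omega)
    exact ⟨a, by omega⟩
  rintro ⟨⟨n, m, l⟩, hn, hm, hl, h⟩
  simp only at hn hm hl h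
  rcases lt_or_gt_of_ne hn with hn | hn <;> rcases lt_or_gt_of_ne hm with hm | hm <;>
    rcases lt_or_gt_of_ne hl with hl | hl
  · omega
  · obtain ⟨a, ha⟩ := neg n hn
    obtain ⟨b, hb⟩ := neg m hm
    refine ⟨((0, false), (a, b)), Subtype.ext ?_⟩
    simp only [tripleMap, tripleEntries, Prod.mk.injEq]
    omega
  · obtain ⟨a, ha⟩ := neg n hn
    obtain ⟨b, hb⟩ := neg l hl
    refine ⟨((1, false), (a, b)), Subtype.ext ?_⟩
    simp only [tripleMap, tripleEntries, Prod.mk.injEq]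
    omega
  · obtain ⟨a, ha⟩ := pos m hm
    obtain ⟨b, hb⟩ := pos l hl
    refine ⟨((2, true), (a, b)), Subtype.ext ?_⟩
    simp only [tripleMap, tripleEntries, Prod.mk.injEq]
    omega
  · obtain ⟨a, ha⟩ := neg m hm
    obtain ⟨b, hb⟩ := neg l hl
    refine ⟨((2, false), (a, b)), Subtype.ext ?_⟩
    simp only [tripleMap, tripleEntries, Prod.mk.injEq]
    omega
  · obtain ⟨a, ha⟩ := pos n hn
    obtain ⟨b, hb⟩ := pos l hl
    refine ⟨((1, true), (a, b)), Subtype.ext ?_⟩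
    simp only [tripleMap, tripleEntries, Prod.mk.injEq]
    omega
  · obtain ⟨a, ha⟩ := pos n hn
    obtain ⟨b, hb⟩ := pos m hm
    refine ⟨((0, true), (a, b)), Subtype.ext ?_⟩
    simp only [tripleMap, tripleEntries, Prod.mk.injEq]
    omega
  · omega

lemma normalOrdered_tripleMap (i : Fin 3) (s : Bool) (a : ℕ+ × ℕ+) :
    normalOrdered [(tripleMap ((i, s), a)).1.1, (tripleMap ((i, s), a)).1.2.1,
      (tripleMap ((i, s), a)).1.2.2] = if s then joinTerm a else splitTerm a := by
  obtain ⟨a, b⟩ := a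
  have ha : (0 : ℤ) < (a : ℕ) := by exact_mod_cast a.pos
  have hb : (0 : ℤ) < (b : ℕ) := by exact_mod_cast b.pos
  have hab : (0 : ℤ) < (a : ℕ) + (b : ℕ) := by omega
  have ha' : ¬ ((a : ℕ) : ℤ) ≤ 0 := by omega
  have hb' : ¬ ((b : ℕ) : ℤ) ≤ 0 := by omega
  have hab' : ¬ ((a : ℕ) : ℤ) + (b : ℕ) ≤ 0 := by omega
  have hna : -((a : ℕ) : ℤ) ≤ 0 := by omega
  have hnb : -((b : ℕ) : ℤ) ≤ 0 := by omega
  have hnab : -(((a : ℕ) : ℤ) + (b : ℕ)) ≤ 0 := by omega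
  have hna' : ¬ 0 < -((a : ℕ) : ℤ) := by omega
  have hnb' : ¬ 0 < -((b : ℕ) : ℤ) := by omega
  have hnab' : ¬ 0 < -(((a : ℕ) : ℤ) + (b : ℕ)) := by omega
  have h1 : mode (((a : ℕ) : ℤ) + (b : ℕ)) = annihilate (a + b) := by
    rw [← mode_natCast, PNat.add_coe, Nat.cast_add]
  have h2 : mode (-(((a : ℕ) : ℤ) + (b : ℕ))) = create (a + b) := by
    rw [← mode_neg_natCast, PNat.add_coe, Nat.cast_add]
  fin_cases i <;> cases s <;>
    simp only [tripleMap, tripleEntries, normalOrdered, List.filter_cons, List.filter_nil, ha, hb,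
      hab, ha', hb', hab', hna, hnb, hnab, hna', hnb', hnab', decide_true, decide_false, if_true,
      Bool.false_eq_true, if_false, List.map_cons, List.map_nil, List.prod_cons, List.prod_nil,
      mul_one, mode_natCast, mode_neg_natCast, h1, h2, splitTerm, joinTerm, mul_assoc]

/-- Each of the two types of cubic terms occurs three times among the zero-sum triples. -/
lemma opSum_normalOrdered :
    (opSum fun t : ZeroSumTriple => normalOrdered [t.1.1, t.1.2.1, t.1.2.2]) =
      (3 : ℂ) • (opSum splitTerm + opSum joinTerm) := by
  refine op_ext fun b => ?_
  set f : ZeroSumTriple → FiniteState :=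
    fun t => normalOrdered [t.1.1, t.1.2.1, t.1.2.2] (ket b) with hf
  have hfx : ∀ i s a, f (tripleMap ((i, s), a)) =
      if s then joinTerm a (ket b) else splitTerm a (ket b) := by
    intro i s a
    rw [hf]
    simp only
    rw [normalOrdered_tripleMap]
    split_ifs <;> rfl
  have h1 : ∑ᶠ x, f (tripleMap x) = ∑ᶠ t, f t :=
    finsum_comp tripleMap ⟨tripleMap_injective, tripleMap_surjective⟩
  have hfin : (fun x => f (tripleMap x)).HasFiniteSupport := by
    refine (Finset.finite_toSet (Finset.univ ×ˢ
      (splittings b.2.support ∪ b.2.support ×ˢ b.2.support))).subset ?_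
    rintro ⟨⟨i, s⟩, a⟩ hx
    by_contra h
    simp only [Finset.coe_product, Finset.coe_univ, Set.mem_prod, Set.mem_univ, true_and,
      Finset.mem_coe, Finset.mem_union, not_or] at h
    refine hx ?_
    simp only [hfx]
    split_ifs
    · exact joinTerm_ket_eq_zero h.2
    · exact splitTerm_ket_eq_zero h.1
  rw [opSum_ket, ← h1, finsum_curry _ hfin, finsum_eq_sum_of_fintype, Fintype.sum_prod_type,
    Fin.sum_univ_three]
  simp only [Fintype.sum_bool, hfx, if_true, Bool.false_eq_true, if_false]
  rw [LinearMap.smul_apply, LinearMap.add_apply, opSum_ket, opSum_ket]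
  module

/-! ### The three Hamiltonians -/

lemma scaledCharge_ket (ν₀ : ℝ) (b : Label) :
    scaledCharge ν₀ (ket b) = (ν₀ * b.1 : ℂ) • ket b := by
  rw [scaledCharge, LinearMap.smul_apply, charge_ket, smul_smul]

lemma pow_ket_of_diagonal {T : Op} {a : ℂ} {b : Label} (h : T (ket b) = a • ket b) (k : ℕ) :
    (T ^ k) (ket b) = a ^ k • ket b := by
  induction k with
  | zero => simp
  | succ k ih => rw [pow_succ, Module.End.mul_apply, h, map_smul, ih, smul_smul, pow_succ, mul_comm]

lemma H₁_ket (ν₀ ν : ℝ) (b : Label) :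
    H₁ ν₀ ν (ket b) = (1 / (ν : ℂ) * (ν₀ * b.1)) • ket b := by
  rw [H₁, LinearMap.smul_apply, scaledCharge_ket, smul_smul]

lemma isTranspose_H₁ (ν₀ ν : ℝ) : IsTranspose (H₁ ν₀ ν) (H₁ ν₀ ν) :=
  isTranspose_of_diagonal _ (H₁_ket ν₀ ν)

lemma opSum_number_ket (T : ℕ+ → Op) (b : Label) :
    (opSum fun n => T n * create n * annihilate n) (ket b) =
      ∑ n ∈ b.2.support, T n (create n (annihilate n (ket b))) :=
  opSum_ket_eq_sum _ _ _ fun n hn => by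
    rw [Module.End.mul_apply, annihilate_ket_of_notMem hn, map_zero]

lemma isTranspose_opSum_number (T : ℕ+ → Op) (f : ℕ+ → Label → ℂ)
    (h : ∀ n b, T n (ket b) = f n b • ket b) :
    IsTranspose (opSum fun n => T n * create n * annihilate n)
      (opSum fun n => T n * create n * annihilate n) := by
  refine isTranspose_of_diagonal
    (fun b => ∑ n ∈ b.2.support, (n : ℂ) * (b.2 n : ℂ) * f n b) fun b => ?_
  rw [opSum_number_ket, Finset.sum_smul]
  refine Finset.sum_congr rfl fun n _ => ?_
  rw [create_annihilate_ket, map_smul, h, smul_smul]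

lemma H₂_eq (ν₀ : ℝ) : H₂ ν₀ = (1 / 2 : ℂ) • scaledCharge ν₀ ^ 2 +
    opSum fun n : ℕ+ => 1 * create n * annihilate n := by
  simp only [H₂, mode_natCast, mode_neg_natCast, one_mul]

lemma H₃_eq (ν₀ ν : ℝ) : H₃ ν₀ ν = (ν : ℂ) • (opSum splitTerm + opSum joinTerm) +
    (opSum fun n : ℕ+ => (((1 - (ν : ℂ) ^ 2) * (n : ℂ)) • (1 : Op) + (2 * (ν : ℂ)) • scaledCharge ν₀)
      * create n * annihilate n) + ((ν : ℂ) / 3) • scaledCharge ν₀ ^ 3 +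
    (-((ν : ℂ) ^ 3 / 12)) • scaledCharge ν₀ := by
  rw [H₃, opSum_normalOrdered, smul_smul, div_mul_cancel₀ _ (by norm_num : (3 : ℂ) ≠ 0)]
  simp only [mode_natCast, mode_neg_natCast]
  refine LinearMap.ext fun η => ?_
  simp only [LinearMap.add_apply, LinearMap.sub_apply, LinearMap.smul_apply]
  module

lemma one_ket_diagonal (n : ℕ+) (b : Label) :
    (fun _ : ℕ+ => (1 : Op)) n (ket b) = (fun _ _ => (1 : ℂ)) n b • ket b := by
  simp

lemma linear_ket_diagonal (ν₀ ν : ℝ) (n : ℕ+) (b : Label) :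
    (fun n : ℕ+ => ((1 - (ν : ℂ) ^ 2) * (n : ℂ)) • (1 : Op) + (2 * (ν : ℂ)) • scaledCharge ν₀) n
      (ket b) = (fun (n : ℕ+) (b : Label) =>
        (1 - (ν : ℂ) ^ 2) * (n : ℂ) + 2 * (ν : ℂ) * (ν₀ * b.1)) n b • ket b := by
  simp only [LinearMap.add_apply, LinearMap.smul_apply, Module.End.one_apply, scaledCharge_ket,
    smul_smul, add_smul]

lemma isTranspose_scaledCharge_pow (ν₀ : ℝ) (k : ℕ) :
    IsTranspose (scaledCharge ν₀ ^ k) (scaledCharge ν₀ ^ k) :=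
  isTranspose_of_diagonal _ fun b => pow_ket_of_diagonal (scaledCharge_ket ν₀ b) k

lemma isTranspose_scaledCharge (ν₀ : ℝ) : IsTranspose (scaledCharge ν₀) (scaledCharge ν₀) :=
  isTranspose_of_diagonal _ (scaledCharge_ket ν₀)

lemma isTranspose_H₂ (ν₀ : ℝ) : IsTranspose (H₂ ν₀) (H₂ ν₀) := by
  rw [H₂_eq]
  exact ((isTranspose_scaledCharge_pow ν₀ 2).smul _).add
    (isTranspose_opSum_number _ _ one_ket_diagonal)

/-- The collective field Hamiltonian is symmetric: transposition exchanges the two types of cubic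
terms. -/
lemma isTranspose_H₃ (ν₀ ν : ℝ) : IsTranspose (H₃ ν₀ ν) (H₃ ν₀ ν) := by
  rw [H₃_eq]
  refine ((IsTranspose.add (IsTranspose.smul _ ?_)
    (isTranspose_opSum_number _ _ (linear_ket_diagonal ν₀ ν))).add
    ((isTranspose_scaledCharge_pow ν₀ 3).smul _)).add ((isTranspose_scaledCharge ν₀).smul _)
  have h1 := opSum_isTranspose locallyFinite_splitTerm locallyFinite_joinTerm isTranspose_splitTerm
  have h2 : IsTranspose (opSum joinTerm) (opSum splitTerm) :=
    isTranspose_of_ket fun b c => (h1.apply_ket c b).symm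
  have h3 := h1.add h2
  rwa [add_comm (opSum joinTerm)] at h3

/-- Functionals on which the creation operators act as multiplication by scalars and the charge
takes a definite value. -/
structure IsCoherent (Ψ : FiniteState →ₗ[ℂ] ℂ) (P : ℕ+ → ℂ) (κ : ℂ) : Prop where
  create : ∀ n η, Ψ (create n η) = P n * Ψ η
  charge : ∀ η, Ψ (charge η) = κ * Ψ η

section

variable {Ψ : FiniteState →ₗ[ℂ] ℂ} {P : ℕ+ → ℂ} {κ : ℂ}

lemma IsCoherent.scaledCharge (hΨ : IsCoherent Ψ P κ) (ν₀ : ℝ) (η : FiniteState) :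
    Ψ (scaledCharge ν₀ η) = ν₀ * κ * Ψ η := by
  rw [ChiralBoson.scaledCharge, LinearMap.smul_apply, map_smul, hΨ.charge, smul_eq_mul, mul_assoc]

lemma IsCoherent.scaledCharge_pow (hΨ : IsCoherent Ψ P κ) (ν₀ : ℝ) (k : ℕ) (η : FiniteState) :
    Ψ ((ChiralBoson.scaledCharge ν₀ ^ k) η) = (ν₀ * κ) ^ k * Ψ η := by
  induction k with
  | zero => simp
  | succ k ih => rw [pow_succ', Module.End.mul_apply, hΨ.scaledCharge, ih, pow_succ']; ring

lemma IsCoherent.H₁ (hΨ : IsCoherent Ψ P κ) (ν₀ ν : ℝ) (η : FiniteState) :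
    Ψ (H₁ ν₀ ν η) = 1 / (ν : ℂ) * (ν₀ * κ) * Ψ η := by
  rw [ChiralBoson.H₁, LinearMap.smul_apply, map_smul, hΨ.scaledCharge, smul_eq_mul]
  ring

lemma IsCoherent.H₂_ket (hΨ : IsCoherent Ψ P κ) (ν₀ : ℝ) (b : Label) :
    Ψ (H₂ ν₀ (ket b)) = (ν₀ * κ) ^ 2 / 2 * Ψ (ket b) +
      ∑ n ∈ b.2.support, P n * Ψ (annihilate n (ket b)) := by
  rw [H₂_eq, LinearMap.add_apply, LinearMap.smul_apply, map_add, map_smul, hΨ.scaledCharge_pow,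
    opSum_number_ket, map_sum]
  simp only [Module.End.one_apply, hΨ.create, smul_eq_mul]
  ring

lemma IsCoherent.H₃_ket (hΨ : IsCoherent Ψ P κ) (ν₀ ν : ℝ) (b : Label) :
    Ψ (H₃ ν₀ ν (ket b)) =
      (ν / 3 * (ν₀ * κ) ^ 3 - ν ^ 3 / 12 * (ν₀ * κ)) * Ψ (ket b) +
      ∑ n ∈ b.2.support, (ν * ∑ a ∈ Finset.Iio n, P a * P (n - a) +
        ((1 - ν ^ 2) * n + 2 * ν * (ν₀ * κ)) * P n) * Ψ (annihilate n (ket b)) +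
      ν * ∑ n ∈ b.2.support, ∑ m ∈ b.2.support, P (n + m) *
        Ψ (annihilate n (annihilate m (ket b))) := by
  have h1 : Ψ (opSum splitTerm (ket b)) =
      ∑ n ∈ b.2.support, (∑ a ∈ Finset.Iio n, P a * P (n - a)) * Ψ (annihilate n (ket b)) := by
    rw [opSum_ket_eq_sum _ _ _ fun _ => splitTerm_ket_eq_zero, map_sum,
      ← sum_splittings _ (fun a c => P a * P c) fun n => Ψ (annihilate n (ket b))]
    refine Finset.sum_congr rfl fun a _ => ?_
    rw [splitTerm, Module.End.mul_apply, Module.End.mul_apply, hΨ.create, hΨ.create, mul_assoc]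
  have h2 : Ψ (opSum joinTerm (ket b)) = ∑ n ∈ b.2.support, ∑ m ∈ b.2.support, P (n + m) *
      Ψ (annihilate n (annihilate m (ket b))) := by
    rw [opSum_ket_eq_sum _ _ _ fun _ => joinTerm_ket_eq_zero, map_sum, Finset.sum_product]
    refine Finset.sum_congr rfl fun n _ => Finset.sum_congr rfl fun m _ => ?_
    rw [joinTerm, Module.End.mul_apply, Module.End.mul_apply, hΨ.create]
  have h3 : ∀ n : ℕ+, Ψ ((((1 - (ν : ℂ) ^ 2) * (n : ℂ)) • (1 : Op) +
      (2 * (ν : ℂ)) • ChiralBoson.scaledCharge ν₀) (ChiralBoson.create n (annihilate n (ket b)))) =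
      (((1 - ν ^ 2) * n + 2 * ν * (ν₀ * κ)) * P n) * Ψ (annihilate n (ket b)) := by
    intro n
    simp only [LinearMap.add_apply, LinearMap.smul_apply, map_add, map_smul, hΨ.scaledCharge,
      Module.End.one_apply, hΨ.create, smul_eq_mul]
    ring
  rw [H₃_eq]
  simp only [LinearMap.add_apply, LinearMap.smul_apply, map_add, map_smul, smul_eq_mul,
    hΨ.scaledCharge, hΨ.scaledCharge_pow]
  rw [opSum_number_ket, map_sum, Finset.sum_congr rfl fun n _ => h3 n,
    h1, h2]
  have h4 : ∀ n : ℕ+, (ν * ∑ a ∈ Finset.Iio n, P a * P (n - a) +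
      ((1 - ν ^ 2) * n + 2 * ν * (ν₀ * κ)) * P n) * Ψ (annihilate n (ket b)) =
      ν * ((∑ a ∈ Finset.Iio n, P a * P (n - a)) * Ψ (annihilate n (ket b))) +
      ((1 - ν ^ 2) * n + 2 * ν * (ν₀ * κ)) * P n * Ψ (annihilate n (ket b)) := fun n => by ring
  rw [Finset.sum_congr rfl fun n _ => h4 n, Finset.sum_add_distrib, ← Finset.mul_sum]
  ring

end

/-! ### Commutators of symmetric operators with quadratic forms -/

lemma prodDefined_ofOp_left {T T' : Op} (hT : IsTranspose T T') (A : QForm) :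
    QForm.ProdDefined (QForm.ofOp T) A := fun b b' => by
  refine summable_of_ne_finset_zero (s := (T' (ket b)).support) fun c hc => ?_
  rw [QForm.ofOp, braket_ket_left, hT.apply_ket, Finsupp.notMem_support_iff.1 hc, zero_mul]

lemma prodDefined_ofOp_right (T : Op) (A : QForm) : QForm.ProdDefined A (QForm.ofOp T) :=
  fun b b' => by
  refine summable_of_ne_finset_zero (s := (T (ket b')).support) fun c hc => ?_
  rw [QForm.ofOp, braket_ket_left, Finsupp.notMem_support_iff.1 hc, mul_zero]

lemma commutatorDefined {T : Op} (hT : IsTranspose T T) (A : QForm) : QForm.CommutatorDefined T A :=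
  ⟨prodDefined_ofOp_left hT A, prodDefined_ofOp_right T A⟩

/-- If `T` is symmetric and `|Q⟩` is an eigenstate of it, then the commutator with `T` acts on matrix
elements through the action of `T` on the left state. -/
lemma eval_commutator_chargeState {T : Op} (hT : IsTranspose T T) (A : QForm) {Q : ℤ} {E : ℂ}
    (hE : T (ket (Q, 0)) = E • ket (Q, 0)) (η : FiniteState) :
    (QForm.commutator T A).eval η (chargeState Q) =
      matrixElement A Q (T (conjState η)) - E * matrixElement A Q (conjState η) := by
  rw [eval_chargeState]
  generalize conjState η = ξ
  induction ξ using Finsupp.induction_linear with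
  | zero => simp
  | add f g hf hg => rw [map_add, map_add, map_add, map_add, hf, hg]; ring
  | single b a =>
    simp only [single_eq_smul_ket, map_smul, smul_eq_mul, matrixElement_ket]
    have h1 : QForm.prod (QForm.ofOp T) A b (Q, 0) = matrixElement A Q (T (ket b)) := by
      rw [QForm.prod, tsum_eq_sum (s := (T (ket b)).support)]
      · rw [matrixElement, Finsupp.linearCombination_apply, Finsupp.sum]
        refine Finset.sum_congr rfl fun c _ => ?_
        rw [QForm.ofOp, braket_ket_left, hT.apply_ket, smul_eq_mul]
      · intro c hc
        rw [QForm.ofOp, braket_ket_left, hT.apply_ket, Finsupp.notMem_support_iff.1 hc, zero_mul]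
    have h2 : QForm.prod A (QForm.ofOp T) b (Q, 0) = E * A b (Q, 0) := by
      rw [QForm.prod, tsum_eq_single ((Q, 0) : Label)]
      · rw [QForm.ofOp, braket_ket_left, hE, Finsupp.smul_apply, ket_apply, if_pos rfl,
          smul_eq_mul, mul_one, mul_comm]
      · intro c hc
        rw [QForm.ofOp, braket_ket_left, hE, Finsupp.smul_apply, ket_apply, if_neg hc.symm,
          smul_zero, mul_zero]
    rw [QForm.commutator, h1, h2]
    ring

lemma H₂_vacuum (ν₀ : ℝ) (Q : ℤ) :
    H₂ ν₀ (ket (Q, 0)) = ((ν₀ * Q : ℂ) ^ 2 / 2) • ket (Q, 0) := by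
  rw [H₂_eq, LinearMap.add_apply, LinearMap.smul_apply,
    pow_ket_of_diagonal (scaledCharge_ket ν₀ (Q, 0)), opSum_number_ket]
  simp only [Finsupp.support_zero, Finset.sum_empty, add_zero, smul_smul]
  ring_nf

lemma H₃_vacuum (ν₀ ν : ℝ) (Q : ℤ) : H₃ ν₀ ν (ket (Q, 0)) =
    (ν / 3 * (ν₀ * Q : ℂ) ^ 3 - ν ^ 3 / 12 * (ν₀ * Q)) • ket (Q, 0) := by
  rw [H₃_eq]
  simp only [LinearMap.add_apply, LinearMap.smul_apply,
    pow_ket_of_diagonal (scaledCharge_ket ν₀ (Q, 0)), scaledCharge_ket,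
    opSum_number_ket]
  rw [opSum_ket_eq_sum splitTerm (Q, 0) ∅ fun a _ => splitTerm_ket_eq_zero (by simp [splittings]),
    opSum_ket_eq_sum joinTerm (Q, 0) ∅ fun a _ => joinTerm_ket_eq_zero (by simp)]
  simp only [Finsupp.support_zero, Finset.sum_empty, add_zero, smul_smul, smul_zero, zero_add,
    ← add_smul]
  ring_nf

/-! ### Algebraic identities for the pair weights -/

lemma pairWeight_add_swap {K : ℕ} {u : Fin K → ℂ} (hu : StrictAnti fun j => (u j).im)
    (j k : Fin K) : pairWeight u j k + pairWeight u k j = 1 := by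
  rcases eq_or_ne j k with rfl | h
  · simp only [pairWeight, if_true]
    norm_num
  · rw [pairWeight, pairWeight, if_neg h, if_neg h.symm, exp_swap (u j) (u k)]
    have h2 : Complex.exp (Complex.I * (u j - u k)) ≠ 1 :=
      exp_ne_one_of_im_ne fun h' => h (hu.injective h')
    have h0 := Complex.exp_ne_zero (Complex.I * (u j - u k))
    set e := Complex.exp (Complex.I * (u j - u k))
    have h4 : 1 - e ≠ 0 := sub_ne_zero.2 h2.symm
    rw [one_div_one_sub_inv h0 h2]
    field_simp
    ring

lemma exp_neg_injective {K : ℕ} {u : Fin K → ℂ} (hu : StrictAnti fun j => (u j).im) {j k : Fin K}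
    (h : j ≠ k) : Complex.exp (-(Complex.I * u j)) - Complex.exp (-(Complex.I * u k)) ≠ 0 := by
  rw [sub_ne_zero]
  intro h1
  refine exp_ne_one_of_im_ne (x := u j) (y := u k) (fun h' => h (hu.injective h')) ?_
  rw [show Complex.I * (u j - u k) = -(Complex.I * u k) - -(Complex.I * u j) by ring,
    Complex.exp_sub, h1, div_self (Complex.exp_ne_zero _)]

lemma pairWeight_eq_div {K : ℕ} {u : Fin K → ℂ} (hu : StrictAnti fun j => (u j).im) {j k : Fin K}
    (h : j ≠ k) : pairWeight u j k = Complex.exp (-(Complex.I * u j)) /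
      (Complex.exp (-(Complex.I * u j)) - Complex.exp (-(Complex.I * u k))) := by
  rw [pairWeight, if_neg h, show Complex.I * (u j - u k) = -(Complex.I * u k) - -(Complex.I * u j)
    by ring, Complex.exp_sub]
  have h1 := exp_neg_injective hu h
  have h2 := Complex.exp_ne_zero (-(Complex.I * u j))
  have h3 : 1 - Complex.exp (-(Complex.I * u k)) / Complex.exp (-(Complex.I * u j)) ≠ 0 := by
    rw [one_sub_div h2]
    exact div_ne_zero h1 h2
  field_simp

/-- The three-term identity behind the absence of three-body interactions, with its corrections on
the diagonals. -/
lemma pairWeight_triple {K : ℕ} {u : Fin K → ℂ} (hu : StrictAnti fun j => (u j).im)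
    (j k l : Fin K) :
    pairWeight u j k * pairWeight u j l + pairWeight u k j * pairWeight u k l +
        pairWeight u l j * pairWeight u l k =
      1 - (if k = j then pairWeight u j l * pairWeight u l j else 0) -
        (if l = k then pairWeight u j k * pairWeight u k j else 0) -
        (if l = j then pairWeight u j k * pairWeight u k j else 0) +
        (if k = j then if l = j then 1 / 2 else 0 else 0) := by
  have hd : ∀ i, pairWeight u i i = 1 / 2 := fun i => by simp [pairWeight]
  have hs := pairWeight_add_swap hu
  rcases eq_or_ne k j with rfl | hkj
  · rcases eq_or_ne l k with rfl | hlk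
    · simp only [hd, if_true]
      norm_num
    · simp only [hd, if_true, if_neg hlk]
      linear_combination (1 + pairWeight u l k) * hs k l
  · rcases eq_or_ne l k with rfl | hlk
    · simp only [hd, if_true, if_neg hkj]
      linear_combination (1 + pairWeight u j l) * hs j l
    · rcases eq_or_ne l j with rfl | hlj
      · simp only [hd, if_true, if_neg hkj, if_neg hlk]
        linear_combination (1 + pairWeight u k l) * hs k l
      · simp only [if_neg hkj, if_neg hlk, if_neg hlj]
        rw [pairWeight_eq_div hu hkj.symm, pairWeight_eq_div hu hlj.symm, pairWeight_eq_div hu hkj,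
          pairWeight_eq_div hu hlk.symm, pairWeight_eq_div hu hlj, pairWeight_eq_div hu hlk]
        have h1 := exp_neg_injective hu hkj
        have h2 := exp_neg_injective hu hlk
        have h3 := exp_neg_injective hu hlj
        have h1' := exp_neg_injective hu hkj.symm
        have h2' := exp_neg_injective hu hlk.symm
        have h3' := exp_neg_injective hu hlj.symm
        set x := Complex.exp (-(Complex.I * u j))
        set y := Complex.exp (-(Complex.I * u k))
        set z := Complex.exp (-(Complex.I * u l))
        field_simp
        ring

section

variable {K : ℕ} {u : Fin K → ℂ}

lemma sum_pairWeight (hu : StrictAnti fun j => (u j).im) (μ : Fin K → ℂ) :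
    ∑ j, ∑ k, μ j * μ k * pairWeight u j k = (∑ j, μ j) ^ 2 / 2 := by
  have h1 : ∑ j, ∑ k, μ j * μ k * pairWeight u j k = ∑ j, ∑ k, μ j * μ k * pairWeight u k j := by
    rw [Finset.sum_comm]
    exact Finset.sum_congr rfl fun j _ => Finset.sum_congr rfl fun k _ => by ring
  have h2 : ∑ j, ∑ k, μ j * μ k * pairWeight u j k + ∑ j, ∑ k, μ j * μ k * pairWeight u k j =
      (∑ j, μ j) ^ 2 := by
    rw [← Finset.sum_add_distrib, sq, Finset.sum_mul_sum]
    refine Finset.sum_congr rfl fun j _ => ?_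
    rw [← Finset.sum_add_distrib]
    refine Finset.sum_congr rfl fun k _ => ?_
    rw [← mul_add, pairWeight_add_swap hu, mul_one]
  rw [← h1] at h2
  linear_combination h2 / 2

lemma sum_triple_pairWeight (hu : StrictAnti fun j => (u j).im) (μ : Fin K → ℂ) :
    ∑ j, ∑ k, ∑ l, μ j * μ k * μ l * (pairWeight u j k * pairWeight u j l) =
      (∑ j, μ j) ^ 3 / 3 + (∑ j, μ j ^ 3) / 6 -
        ∑ j, ∑ k, μ j ^ 2 * μ k * (pairWeight u j k * pairWeight u k j) := by
  set S := ∑ j, ∑ k, ∑ l, μ j * μ k * μ l * (pairWeight u j k * pairWeight u j l) with hS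
  set V := ∑ j, ∑ k, μ j ^ 2 * μ k * (pairWeight u j k * pairWeight u k j) with hV
  have h2 : ∑ j, ∑ k, ∑ l, μ j * μ k * μ l * (pairWeight u k j * pairWeight u k l) = S := by
    rw [Finset.sum_comm]
    exact Finset.sum_congr rfl fun j _ => Finset.sum_congr rfl fun k _ =>
      Finset.sum_congr rfl fun l _ => by ring
  have h3 : ∑ j, ∑ k, ∑ l, μ j * μ k * μ l * (pairWeight u l j * pairWeight u l k) = S := by
    rw [Finset.sum_congr rfl fun j _ => Finset.sum_comm, Finset.sum_comm]
    exact Finset.sum_congr rfl fun j _ => Finset.sum_congr rfl fun k _ =>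
      Finset.sum_congr rfl fun l _ => by ring
  have h4 : ∑ j, ∑ k, ∑ l, μ j * μ k * μ l * (pairWeight u j k * pairWeight u j l +
      pairWeight u k j * pairWeight u k l + pairWeight u l j * pairWeight u l k) = 3 * S := by
    simp only [mul_add, Finset.sum_add_distrib]
    rw [h2, h3, ← hS]
    ring
  have h5 : (∑ j, μ j) ^ 3 = ∑ j, ∑ k, ∑ l, μ j * μ k * μ l := by
    rw [pow_succ, sq, Finset.sum_mul_sum, Finset.sum_mul]
    refine Finset.sum_congr rfl fun j _ => ?_
    rw [Finset.sum_mul_sum]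
  have h6 : ∑ j, ∑ l, μ j * μ j * μ l * (pairWeight u j l * pairWeight u l j) = V :=
    Finset.sum_congr rfl fun j _ => Finset.sum_congr rfl fun k _ => by ring
  have h7 : ∑ j, ∑ k, μ j * μ k * μ k * (pairWeight u j k * pairWeight u k j) = V := by
    rw [Finset.sum_comm]
    exact Finset.sum_congr rfl fun j _ => Finset.sum_congr rfl fun k _ => by ring
  have h8 : ∑ j, ∑ k, μ j * μ k * μ j * (pairWeight u j k * pairWeight u k j) = V :=
    Finset.sum_congr rfl fun j _ => Finset.sum_congr rfl fun k _ => by ring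
  have h9 : ∑ j, μ j * μ j * μ j * (1 / 2) = (∑ j, μ j ^ 3) / 2 := by
    rw [Finset.sum_div]
    exact Finset.sum_congr rfl fun j _ => by ring
  simp only [pairWeight_triple hu, mul_add, mul_sub, mul_ite, mul_one, mul_zero,
    Finset.sum_add_distrib, Finset.sum_sub_distrib] at h4
  have e1 : ∑ j, ∑ k, ∑ l, (if k = j then μ j * μ k * μ l *
      (pairWeight u j l * pairWeight u l j) else 0) = V := by
    rw [← h6]
    refine Finset.sum_congr rfl fun j _ => ?_
    rw [Finset.sum_comm]
    simp
  have e2 : ∑ j, ∑ k, ∑ l, (if k = j then if l = j then μ j * μ k * μ l * (1 / 2) else 0 else 0) =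
      (∑ j, μ j ^ 3) / 2 := by
    rw [← h9]
    refine Finset.sum_congr rfl fun j _ => ?_
    rw [Finset.sum_comm]
    simp
  rw [e1, e2] at h4
  simp only [Finset.sum_ite_eq', Finset.mem_univ, if_true] at h4
  rw [h7, h8, ← h5] at h4
  linear_combination -h4 / 3

/-- The scalar part of the kinetic terms. The three-body terms sum to constants, so besides
constants only two-body terms are left. -/
lemma sum_localMomentum_sq (hu : StrictAnti fun j => (u j).im) (μ : Fin K → ℂ) (q : ℂ) :
    ∑ j, μ j * (q + ∑ k, μ k * pairWeight u j k) ^ 2 =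
      q ^ 2 * (∑ j, μ j) + q * (∑ j, μ j) ^ 2 + (∑ j, μ j) ^ 3 / 3 + (∑ j, μ j ^ 3) / 6 -
        ∑ j, ∑ k, μ j ^ 2 * μ k * (pairWeight u j k * pairWeight u k j) := by
  have h1 : ∀ j, μ j * (q + ∑ k, μ k * pairWeight u j k) ^ 2 =
      q ^ 2 * μ j + 2 * q * ∑ k, μ j * μ k * pairWeight u j k +
        ∑ k, ∑ l, μ j * μ k * μ l * (pairWeight u j k * pairWeight u j l) := by
    intro j
    have e1 : ∑ k, μ j * μ k * pairWeight u j k = μ j * ∑ k, μ k * pairWeight u j k := by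
      rw [Finset.mul_sum]
      exact Finset.sum_congr rfl fun k _ => by ring
    have e2 : ∑ k, ∑ l, μ j * μ k * μ l * (pairWeight u j k * pairWeight u j l) =
        μ j * (∑ k, μ k * pairWeight u j k) ^ 2 := by
      rw [sq, Finset.sum_mul_sum, Finset.mul_sum]
      refine Finset.sum_congr rfl fun k _ => ?_
      rw [Finset.mul_sum]
      exact Finset.sum_congr rfl fun l _ => by ring
    rw [e1, e2]
    ring
  rw [Finset.sum_congr rfl fun j _ => h1 j, Finset.sum_add_distrib, Finset.sum_add_distrib,
    ← Finset.mul_sum, ← Finset.mul_sum, sum_pairWeight hu, sum_triple_pairWeight hu]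
  ring

lemma sum_range_pnat (F : ℕ → ℂ) (n : ℕ+) :
    ∑ i ∈ Finset.range n, F i = F 0 + ∑ a ∈ Finset.Iio n, F (a : ℕ) := by
  have h : (Finset.Iio n).map ⟨((↑) : ℕ+ → ℕ), PNat.coe_injective⟩ =
      (Finset.range (n : ℕ)).erase 0 := by
    ext i
    simp only [Finset.mem_map, Finset.mem_Iio, Function.Embedding.coeFn_mk, Finset.mem_erase,
      Finset.mem_range]
    constructor
    · rintro ⟨a, ha, rfl⟩
      exact ⟨a.ne_zero, by exact_mod_cast ha⟩
    · rintro ⟨h0, h1⟩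
      exact ⟨⟨i, Nat.pos_of_ne_zero h0⟩, by exact_mod_cast h1, rfl⟩
  rw [← Finset.add_sum_erase _ _ (Finset.mem_range.2 n.pos), ← h, Finset.sum_map]
  rfl

/-- The cross terms between the pair factors and the excitation of mode `n`, as a polynomial in power
sums and a one-body correction. -/
lemma sum_pairWeight_pow (hu : StrictAnti fun j => (u j).im) (μ : Fin K → ℂ) (n : ℕ+) :
    2 * ∑ j, ∑ k, μ j * μ k * pairWeight u j k * Complex.exp (-(Complex.I * u j)) ^ (n : ℕ) =
      ∑ a ∈ Finset.Iio n, (∑ j, μ j * Complex.exp (-(Complex.I * u j)) ^ (a : ℕ)) *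
          (∑ j, μ j * Complex.exp (-(Complex.I * u j)) ^ ((n - a : ℕ+) : ℕ)) +
        2 * (∑ j, μ j) * (∑ j, μ j * Complex.exp (-(Complex.I * u j)) ^ (n : ℕ)) -
        n * ∑ j, μ j ^ 2 * Complex.exp (-(Complex.I * u j)) ^ (n : ℕ) := by
  set z : Fin K → ℂ := fun j => Complex.exp (-(Complex.I * u j)) with hz
  -- the symmetrized sum is a geometric sum, up to a correction on the diagonal
  have key : ∀ j k, pairWeight u j k * z j ^ (n : ℕ) + pairWeight u k j * z k ^ (n : ℕ) =
      ∑ i ∈ Finset.range (n + 1), z j ^ i * z k ^ ((n : ℕ) - i) -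
        (if k = j then (n : ℂ) * z j ^ (n : ℕ) else 0) := by
    intro j k
    rcases eq_or_ne k j with rfl | h
    · have h1 : ∀ i ∈ Finset.range ((n : ℕ) + 1), z k ^ i * z k ^ ((n : ℕ) - i) = z k ^ (n : ℕ) := by
        intro i hi
        rw [← pow_add, Nat.add_sub_of_le (Nat.lt_succ_iff.1 (Finset.mem_range.1 hi))]
      rw [Finset.sum_congr rfl h1]
      simp only [Finset.sum_const, Finset.card_range, nsmul_eq_mul, pairWeight, if_true]
      push_cast
      ring
    · have h1 := (Commute.all (z j) (z k)).geom_sum₂_mul ((n : ℕ) + 1)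
      simp only [Nat.add_sub_cancel] at h1
      rw [if_neg h, sub_zero, pairWeight_eq_div hu h.symm, pairWeight_eq_div hu h]
      have h2 := exp_neg_injective hu h.symm
      have h3 := exp_neg_injective hu h
      simp only [hz] at h1 ⊢
      refine mul_right_cancel₀ h2 ?_
      rw [h1]
      field_simp
      ring
  have h0 : ∑ j, ∑ k, μ j * μ k * pairWeight u j k * z j ^ (n : ℕ) =
      ∑ j, ∑ k, μ j * μ k * pairWeight u k j * z k ^ (n : ℕ) := by
    rw [Finset.sum_comm]
    exact Finset.sum_congr rfl fun j _ => Finset.sum_congr rfl fun k _ => by ring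
  have h1 : 2 * ∑ j, ∑ k, μ j * μ k * pairWeight u j k * z j ^ (n : ℕ) =
      ∑ j, ∑ k, μ j * μ k *
        (pairWeight u j k * z j ^ (n : ℕ) + pairWeight u k j * z k ^ (n : ℕ)) := by
    rw [two_mul]
    nth_rewrite 2 [h0]
    simp only [← Finset.sum_add_distrib]
    exact Finset.sum_congr rfl fun j _ => Finset.sum_congr rfl fun k _ => by ring
  have h2 : ∑ j, ∑ k, μ j * μ k * ∑ i ∈ Finset.range ((n : ℕ) + 1), z j ^ i * z k ^ ((n : ℕ) - i) =
      ∑ i ∈ Finset.range ((n : ℕ) + 1), (∑ j, μ j * z j ^ i) * ∑ k, μ k * z k ^ ((n : ℕ) - i) := by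
    simp only [Finset.sum_mul_sum]
    symm
    rw [Finset.sum_comm]
    refine Finset.sum_congr rfl fun j _ => ?_
    rw [Finset.sum_comm]
    refine Finset.sum_congr rfl fun k _ => ?_
    rw [Finset.mul_sum]
    exact Finset.sum_congr rfl fun i _ => by ring
  have h3 : ∀ a ∈ Finset.Iio n, (∑ j, μ j * z j ^ (a : ℕ)) * ∑ k, μ k * z k ^ ((n : ℕ) - (a : ℕ)) =
      (∑ j, μ j * z j ^ (a : ℕ)) * ∑ k, μ k * z k ^ ((n - a : ℕ+) : ℕ) := by
    intro a ha
    rw [PNat.sub_coe, if_pos (Finset.mem_Iio.1 ha)]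
  rw [h1]
  simp only [key, mul_sub, Finset.sum_sub_distrib, mul_ite, mul_zero, Finset.sum_ite_eq',
    Finset.mem_univ, if_true]
  rw [h2, Finset.sum_range_succ, sum_range_pnat
    (fun i => (∑ j, μ j * z j ^ i) * ∑ k, μ k * z k ^ ((n : ℕ) - i)), Finset.sum_congr rfl h3]
  simp only [pow_zero, mul_one, Nat.sub_zero, Nat.sub_self]
  have h4 : ∑ j, μ j * μ j * ((n : ℂ) * z j ^ (n : ℕ)) = n * ∑ j, μ j ^ 2 * z j ^ (n : ℕ) := by
    rw [Finset.mul_sum]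
    exact Finset.sum_congr rfl fun j _ => by ring
  rw [h4]
  ring

end

lemma pairPotential_eq {K : ℕ} {u : Fin K → ℂ} (hu : StrictAnti fun j => (u j).im) {j k : Fin K}
    (h : j ≠ k) : pairPotential (u j - u k) = 2 * (pairWeight u j k * pairWeight u k j) := by
  rw [pairWeight, pairWeight, if_neg h, if_neg h.symm, exp_swap (u j) (u k), pairPotential,
    Complex.sin]
  have h1 : Complex.exp (Complex.I * (u j - u k)) ≠ 1 :=
    exp_ne_one_of_im_ne fun h' => h (hu.injective h')
  have h2 : Complex.exp (Complex.I * (u j - u k)) =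
      Complex.exp ((u j - u k) / 2 * Complex.I) ^ 2 := by
    rw [← Complex.exp_nat_mul]
    push_cast
    ring_nf
  rw [neg_mul, Complex.exp_neg]
  rw [h2] at h1 ⊢
  have h0 := Complex.exp_ne_zero ((u j - u k) / 2 * Complex.I)
  set f := Complex.exp ((u j - u k) / 2 * Complex.I)
  have h4 : 1 - f ^ 2 ≠ 0 := sub_ne_zero.2 h1.symm
  have h8 : 2 * ((f⁻¹ - f) * Complex.I / 2) ^ 2 = -((1 - f ^ 2) ^ 2 / (2 * f ^ 2)) := by
    have h9 : (f⁻¹ - f) = (1 - f ^ 2) / f := by field_simp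
    rw [h9, div_pow, mul_pow, Complex.I_sq]
    field_simp
  rw [one_div_one_sub_inv (pow_ne_zero 2 h0) h1, h8]
  field_simp

/-! ### The Hamiltonians as differential operators -/

lemma vertexFunctional_isCoherent (ν₀ : ℝ) {K : ℕ} (ℓ : Fin K → ℤ) (Q : ℤ) {u : Fin K → ℂ}
    (hu : StrictAnti fun j => (u j).im) :
    IsCoherent (vertexFunctional ν₀ ℓ Q u) (powerSum ν₀ ℓ u) (Q + ∑ j, (ℓ j : ℂ)) := by
  refine ⟨vertexFunctional_create ν₀ ℓ Q hu, fun η => ?_⟩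
  induction η using Finsupp.induction_linear with
  | zero => simp
  | add f g hf hg => simp only [map_add, hf, hg, mul_add]
  | single b a =>
    simp only [single_eq_smul_ket, map_smul, smul_eq_mul, charge_ket]
    by_cases h : b.1 = Q + ∑ j, ℓ j
    · rw [h]
      push_cast
      ring
    · rw [vertexFunctional, matrixElement_ket, (vertexProduct_spec ν₀ ℓ u hu).2.charge_eq _ _ h]
      ring

lemma lowering_lowering_ket (γ : ℕ+ → ℂ) (b : Label) :
    lowering γ (lowering γ (ket b)) = ∑ n ∈ b.2.support, ∑ m ∈ b.2.support,
      (γ n * γ m) • annihilate n (annihilate m (ket b)) := by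
  have h : ∀ n, lowering γ (annihilate n (ket b)) =
      ∑ m ∈ b.2.support, γ m • annihilate n (annihilate m (ket b)) := fun n => by
    rw [op_apply_comm (lowering_annihilate γ n), lowering_ket γ b _ subset_rfl, map_sum]
    simp only [map_smul]
  conv_lhs => rw [lowering_ket γ b _ subset_rfl, map_sum]
  refine Finset.sum_congr rfl fun n _ => ?_
  rw [map_smul, h, Finset.smul_sum]
  simp only [smul_smul]

lemma exp_neg_mul (n : ℕ+) (t : ℂ) :
    Complex.exp (-(Complex.I * n * t)) = Complex.exp (-(Complex.I * t)) ^ (n : ℕ) := by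
  rw [← Complex.exp_nat_mul]
  ring_nf

section

variable (ν₀ : ℝ) {K : ℕ} (ℓ : Fin K → ℤ) (Q : ℤ) {u : Fin K → ℂ}

lemma vertexFunctional_modeField_ket (t : ℂ) (b : Label) :
    vertexFunctional ν₀ ℓ Q u (modeField t (ket b)) = ∑ n ∈ b.2.support,
      Complex.exp (-(Complex.I * t)) ^ (n : ℕ) * vertexFunctional ν₀ ℓ Q u (annihilate n (ket b)) := by
  rw [modeField, lowering_ket _ b _ subset_rfl, map_sum]
  simp only [map_smul, smul_eq_mul, exp_neg_mul]

lemma vertexFunctional_modeFieldDeriv_ket (t : ℂ) (b : Label) :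
    vertexFunctional ν₀ ℓ Q u (modeFieldDeriv t (ket b)) = ∑ n ∈ b.2.support,
      n * Complex.exp (-(Complex.I * t)) ^ (n : ℕ) *
        vertexFunctional ν₀ ℓ Q u (annihilate n (ket b)) := by
  rw [modeFieldDeriv, lowering_ket _ b _ subset_rfl, map_sum]
  simp only [map_smul, smul_eq_mul, exp_neg_mul]

lemma vertexFunctional_modeField_modeField_ket (t : ℂ) (b : Label) :
    vertexFunctional ν₀ ℓ Q u (modeField t (modeField t (ket b))) =
      ∑ n ∈ b.2.support, ∑ m ∈ b.2.support, Complex.exp (-(Complex.I * t)) ^ ((n + m : ℕ+) : ℕ) *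
        vertexFunctional ν₀ ℓ Q u (annihilate n (annihilate m (ket b))) := by
  rw [modeField, lowering_lowering_ket, map_sum]
  simp only [map_sum, map_smul, smul_eq_mul, exp_neg_mul, PNat.add_coe, pow_add]

/-- Up to its eigenvalue on `|Q⟩`, the CFT Hamiltonian acts as `i ∑ⱼ ∂ⱼ`, with the derivatives written
out. -/
lemma vertexFunctional_H₂ (hu : StrictAnti fun j => (u j).im) (η : FiniteState) :
    vertexFunctional ν₀ ℓ Q u (H₂ ν₀ η) - (ν₀ * Q) ^ 2 / 2 * vertexFunctional ν₀ ℓ Q u η =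
      ∑ j, (ℓ j * ν₀ : ℂ) * (localMomentum ν₀ ℓ Q u j * vertexFunctional ν₀ ℓ Q u η +
        vertexFunctional ν₀ ℓ Q u (modeField (u j) η)) := by
  induction η using Finsupp.induction_linear with
  | zero => simp
  | add f g hf hg =>
    simp only [map_add, mul_add, Finset.sum_add_distrib] at hf hg ⊢
    linear_combination hf + hg
  | single b a =>
    simp only [single_eq_smul_ket, map_smul, smul_eq_mul]
    suffices h : vertexFunctional ν₀ ℓ Q u (H₂ ν₀ (ket b)) -
        (ν₀ * Q) ^ 2 / 2 * vertexFunctional ν₀ ℓ Q u (ket b) =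
        ∑ j, (ℓ j * ν₀ : ℂ) * (localMomentum ν₀ ℓ Q u j * vertexFunctional ν₀ ℓ Q u (ket b) +
          vertexFunctional ν₀ ℓ Q u (modeField (u j) (ket b))) by
      have h' := congrArg (fun x => a * x) h
      simp only [Finset.mul_sum, mul_sub] at h'
      refine Eq.trans (by ring) (h'.trans (Finset.sum_congr rfl fun j _ => by ring))
    rw [(vertexFunctional_isCoherent ν₀ ℓ Q hu).H₂_ket]
    simp only [vertexFunctional_modeField_ket, mul_add, Finset.sum_add_distrib]
    have h1 := sum_pairWeight hu fun j => (ℓ j * ν₀ : ℂ)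
    have h2 : ∑ j, (ℓ j * ν₀ : ℂ) * (localMomentum ν₀ ℓ Q u j * vertexFunctional ν₀ ℓ Q u (ket b)) =
        ((ν₀ * Q) * (∑ j, (ℓ j * ν₀ : ℂ)) + (∑ j, (ℓ j * ν₀ : ℂ)) ^ 2 / 2) *
          vertexFunctional ν₀ ℓ Q u (ket b) := by
      rw [← h1, Finset.mul_sum, ← Finset.sum_add_distrib, Finset.sum_mul]
      refine Finset.sum_congr rfl fun j _ => ?_
      simp only [localMomentum, mul_assoc, ← Finset.mul_sum]
      ring
    have h3 : ∑ j, (ℓ j * ν₀ : ℂ) * ∑ n ∈ b.2.support, Complex.exp (-(Complex.I * u j)) ^ (n : ℕ) *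
          vertexFunctional ν₀ ℓ Q u (annihilate n (ket b)) =
        ∑ n ∈ b.2.support, powerSum ν₀ ℓ u n *
          vertexFunctional ν₀ ℓ Q u (annihilate n (ket b)) := by
      simp only [powerSum, Finset.mul_sum, Finset.sum_mul, exp_neg_mul]
      rw [Finset.sum_comm]
      exact Finset.sum_congr rfl fun n _ => Finset.sum_congr rfl fun j _ => by ring
    rw [h2, h3, ← Finset.sum_mul]
    ring

/-- Up to its eigenvalue on `|Q⟩`, the collective field Hamiltonian acts as the differential operator with kinetic terms
`-(ν / μⱼ) ∂ⱼ ^ 2`, whose explicit form is inserted here, and pair potentials. -/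
lemma vertexFunctional_H₃ (hu : StrictAnti fun j => (u j).im) {ν : ℝ}
    (hν : ∀ j, (ν : ℂ) * (1 - (ℓ j * ν₀ : ℂ) ^ 2) = (1 - (ν : ℂ) ^ 2) * (ℓ j * ν₀ : ℂ))
    (η : FiniteState) :
    vertexFunctional ν₀ ℓ Q u (H₃ ν₀ ν η) - (ν / 3 * (ν₀ * Q) ^ 3 - ν ^ 3 / 12 * (ν₀ * Q)) *
        vertexFunctional ν₀ ℓ Q u η =
      ∑ j, ν * ((∑ k, (ℓ k * ν₀) * (pairWeight u j k * pairWeight u k j) - ℓ j * ν₀ / 4) *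
            vertexFunctional ν₀ ℓ Q u η +
          vertexFunctional ν₀ ℓ Q u (modeFieldDeriv (u j) η) +
          ℓ j * ν₀ * (localMomentum ν₀ ℓ Q u j ^ 2 * vertexFunctional ν₀ ℓ Q u η +
            2 * localMomentum ν₀ ℓ Q u j * vertexFunctional ν₀ ℓ Q u (modeField (u j) η) +
            vertexFunctional ν₀ ℓ Q u (modeField (u j) (modeField (u j) η)))) +
      (∑ j, ∑ k ∈ Finset.Ioi j, -(ν / 2 * (ℓ j * ν₀ + ℓ k * ν₀) * (1 - (ℓ j * ν₀) * (ℓ k * ν₀))) *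
        pairPotential (u j - u k)) * vertexFunctional ν₀ ℓ Q u η +
      (ν * ∑ j, (ℓ j * ν₀ : ℂ) ^ 3 - ν ^ 3 * ∑ j, (ℓ j * ν₀ : ℂ)) / 12 *
        vertexFunctional ν₀ ℓ Q u η := by
  induction η using Finsupp.induction_linear with
  | zero => simp
  | add f g hf hg =>
    simp only [map_add, mul_add, Finset.sum_add_distrib] at hf hg ⊢
    linear_combination hf + hg
  | single b a =>
    simp only [single_eq_smul_ket, map_smul, smul_eq_mul]
    set Ψ := vertexFunctional ν₀ ℓ Q u with hΨ
    set μ : Fin K → ℂ := fun j => (ℓ j * ν₀ : ℂ) with hμ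
    set z : Fin K → ℂ := fun j => Complex.exp (-(Complex.I * u j)) with hz
    set A := localMomentum ν₀ ℓ Q u with hA
    set V : Fin K → ℂ := fun j => ∑ k, μ k * (pairWeight u j k * pairWeight u k j) - μ j / 4 with hV
    set U : ℂ := ∑ j, ∑ k ∈ Finset.Ioi j, -(ν / 2 * (μ j + μ k) * (1 - μ j * μ k)) *
      pairPotential (u j - u k) with hU
    set p := ∑ j, μ j with hp
    set p₃ := ∑ j, μ j ^ 3 with hp₃
    have hp' : p = ν₀ * ∑ j, (ℓ j : ℂ) := by
      rw [hp, Finset.mul_sum]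
      exact Finset.sum_congr rfl fun j _ => mul_comm _ _
    have hP : ∀ n : ℕ+, powerSum ν₀ ℓ u n = ∑ j, μ j * z j ^ (n : ℕ) := fun n => by
      simp only [powerSum, exp_neg_mul, hμ, hz]
    have hAj : ∀ j, A j = ν₀ * Q + ∑ k, μ k * pairWeight u j k := fun j => rfl
    -- the scalar part
    have hscalar : ∑ j, ν * (V j + μ j * A j ^ 2) + U + (ν * p₃ - ν ^ 3 * p) / 12 =
        (ν / 3 * (ν₀ * Q + p) ^ 3 - ν ^ 3 / 12 * (ν₀ * Q + p)) -
          (ν / 3 * (ν₀ * Q) ^ 3 - ν ^ 3 / 12 * (ν₀ * Q)) := by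
      have h1 := sum_localMomentum_sq hu μ (ν₀ * Q)
      have h2 : U = -(∑ j, ∑ k, ν * (μ k - μ j ^ 2 * μ k) * (pairWeight u j k * pairWeight u k j) -
          ∑ j, ν * (μ j - μ j ^ 3) / 4) := by
        have e1 : ∑ j, ν * (μ j - μ j ^ 3) / 4 =
            ∑ j, ν * (μ j - μ j ^ 2 * μ j) * (pairWeight u j j * pairWeight u j j) :=
          Finset.sum_congr rfl fun j _ => by
            simp only [pairWeight, if_true]
            ring
        rw [e1, ← sum_Ioi_add_swap fun j k =>
          ν * (μ k - μ j ^ 2 * μ k) * (pairWeight u j k * pairWeight u k j), hU,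
          ← Finset.sum_neg_distrib]
        refine Finset.sum_congr rfl fun j _ => ?_
        rw [← Finset.sum_neg_distrib]
        refine Finset.sum_congr rfl fun k hk => ?_
        rw [pairPotential_eq hu (Finset.mem_Ioi.1 hk).ne]
        ring
      have h3 : ∑ j, ν * (V j + μ j * A j ^ 2) =
          ν * (∑ j, ∑ k, μ k * (pairWeight u j k * pairWeight u k j) - p / 4 +
            ∑ j, μ j * (ν₀ * Q + ∑ k, μ k * pairWeight u j k) ^ 2) := by
        rw [← Finset.mul_sum, Finset.sum_add_distrib, hV, Finset.sum_sub_distrib, hp,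
          Finset.sum_div]
        simp only [hAj]
      have h4 : ∑ j, ∑ k, ν * (μ k - μ j ^ 2 * μ k) * (pairWeight u j k * pairWeight u k j) =
          ν * (∑ j, ∑ k, μ k * (pairWeight u j k * pairWeight u k j) -
            ∑ j, ∑ k, μ j ^ 2 * μ k * (pairWeight u j k * pairWeight u k j)) := by
        simp only [← Finset.sum_sub_distrib, Finset.mul_sum]
        exact Finset.sum_congr rfl fun j _ => Finset.sum_congr rfl fun k _ => by ring
      have h5 : ∑ j, ν * (μ j - μ j ^ 3) / 4 = ν * (p - p₃) / 4 := by
        rw [← Finset.sum_div, ← Finset.mul_sum, Finset.sum_sub_distrib]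
      rw [h3, h1, h2, h4, h5, ← hp, ← hp₃]
      ring
    -- the part linear in the annihilation operators
    have hlinear : ∀ n : ℕ+, ∑ j, ν * (n * z j ^ (n : ℕ) + μ j * (2 * A j * z j ^ (n : ℕ))) =
        ν * ∑ a ∈ Finset.Iio n, powerSum ν₀ ℓ u a * powerSum ν₀ ℓ u (n - a) +
          ((1 - ν ^ 2) * n + 2 * ν * (ν₀ * Q + p)) * powerSum ν₀ ℓ u n := by
      intro n
      have h1 := sum_pairWeight_pow hu μ n
      have h2 : ∑ j, ν * (n * z j ^ (n : ℕ) + μ j * (2 * A j * z j ^ (n : ℕ))) =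
          n * ∑ j, ν * z j ^ (n : ℕ) + 2 * ν * (ν₀ * Q) * ∑ j, μ j * z j ^ (n : ℕ) +
            ν * (2 * ∑ j, ∑ k, μ j * μ k * pairWeight u j k * z j ^ (n : ℕ)) := by
        simp only [Finset.mul_sum, ← Finset.sum_add_distrib]
        refine Finset.sum_congr rfl fun j _ => ?_
        have e1 : ∑ k, ν * (2 * (μ j * μ k * pairWeight u j k * z j ^ (n : ℕ))) =
            2 * ν * μ j * z j ^ (n : ℕ) * ∑ k, μ k * pairWeight u j k := by
          rw [Finset.mul_sum]
          exact Finset.sum_congr rfl fun k _ => by ring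
        rw [e1, hAj]
        ring
      have h3 : ∑ j, ν * z j ^ (n : ℕ) - ν * ∑ j, μ j ^ 2 * z j ^ (n : ℕ) =
          (1 - ν ^ 2) * ∑ j, μ j * z j ^ (n : ℕ) := by
        rw [Finset.mul_sum, Finset.mul_sum, ← Finset.sum_sub_distrib]
        refine Finset.sum_congr rfl fun j _ => ?_
        linear_combination (z j ^ (n : ℕ)) * hν j
      simp only [hP]
      rw [h2, h1, ← hp]
      linear_combination (n : ℂ) * h3
    have hket : Ψ (H₃ ν₀ ν (ket b)) - (ν / 3 * (ν₀ * Q) ^ 3 - ν ^ 3 / 12 * (ν₀ * Q)) * Ψ (ket b) =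
        ∑ j, ν * (V j * Ψ (ket b) + Ψ (modeFieldDeriv (u j) (ket b)) +
          μ j * (A j ^ 2 * Ψ (ket b) + 2 * A j * Ψ (modeField (u j) (ket b)) +
            Ψ (modeField (u j) (modeField (u j) (ket b))))) + U * Ψ (ket b) +
        (ν * p₃ - ν ^ 3 * p) / 12 * Ψ (ket b) := by
      have h1 : ∀ j, ν * (V j * Ψ (ket b) + Ψ (modeFieldDeriv (u j) (ket b)) +
          μ j * (A j ^ 2 * Ψ (ket b) + 2 * A j * Ψ (modeField (u j) (ket b)) +
            Ψ (modeField (u j) (modeField (u j) (ket b))))) =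
          ν * (V j + μ j * A j ^ 2) * Ψ (ket b) +
          ∑ n ∈ b.2.support, ν * (n * z j ^ (n : ℕ) + μ j * (2 * A j * z j ^ (n : ℕ))) *
            Ψ (annihilate n (ket b)) +
          ∑ n ∈ b.2.support, ∑ m ∈ b.2.support, ν * (μ j * z j ^ ((n + m : ℕ+) : ℕ)) *
            Ψ (annihilate n (annihilate m (ket b))) := by
        intro j
        have e1 : ∑ n ∈ b.2.support, ν * (n * z j ^ (n : ℕ) + μ j * (2 * A j * z j ^ (n : ℕ))) *
            Ψ (annihilate n (ket b)) = ν * Ψ (modeFieldDeriv (u j) (ket b)) +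
              ν * μ j * (2 * A j) * Ψ (modeField (u j) (ket b)) := by
          rw [vertexFunctional_modeFieldDeriv_ket, vertexFunctional_modeField_ket, Finset.mul_sum,
            Finset.mul_sum, ← Finset.sum_add_distrib]
          exact Finset.sum_congr rfl fun n _ => by ring
        have e2 : ∑ n ∈ b.2.support, ∑ m ∈ b.2.support, ν * (μ j * z j ^ ((n + m : ℕ+) : ℕ)) *
            Ψ (annihilate n (annihilate m (ket b))) =
            ν * μ j * Ψ (modeField (u j) (modeField (u j) (ket b))) := by
          rw [vertexFunctional_modeField_modeField_ket, Finset.mul_sum]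
          refine Finset.sum_congr rfl fun n _ => ?_
          rw [Finset.mul_sum]
          exact Finset.sum_congr rfl fun m _ => by ring
        rw [e1, e2]
        ring
      have h2 : ∑ j, ∑ n ∈ b.2.support,
          ν * (n * z j ^ (n : ℕ) + μ j * (2 * A j * z j ^ (n : ℕ))) * Ψ (annihilate n (ket b)) =
          ∑ n ∈ b.2.support, (ν * ∑ a ∈ Finset.Iio n, powerSum ν₀ ℓ u a * powerSum ν₀ ℓ u (n - a) +
          ((1 - ν ^ 2) * n + 2 * ν * (ν₀ * Q + p)) * powerSum ν₀ ℓ u n) *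
            Ψ (annihilate n (ket b)) := by
        rw [Finset.sum_comm]
        refine Finset.sum_congr rfl fun n _ => ?_
        rw [← hlinear, Finset.sum_mul]
      have h3 : ∑ j, ∑ n ∈ b.2.support, ∑ m ∈ b.2.support, ν * (μ j * z j ^ ((n + m : ℕ+) : ℕ)) *
            Ψ (annihilate n (annihilate m (ket b))) =
          ν * ∑ n ∈ b.2.support, ∑ m ∈ b.2.support, powerSum ν₀ ℓ u (n + m) *
            Ψ (annihilate n (annihilate m (ket b))) := by
        rw [Finset.sum_comm, Finset.mul_sum]
        refine Finset.sum_congr rfl fun n _ => ?_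
        rw [Finset.sum_comm, Finset.mul_sum]
        refine Finset.sum_congr rfl fun m _ => ?_
        rw [hP, ← mul_assoc, Finset.mul_sum, Finset.sum_mul]
      rw [Finset.sum_congr rfl fun j _ => h1 j, Finset.sum_add_distrib, Finset.sum_add_distrib, h2,
        h3, ← Finset.sum_mul, (vertexFunctional_isCoherent ν₀ ℓ Q hu).H₃_ket,
        show (ν₀ * ((Q : ℂ) + ∑ j, (ℓ j : ℂ))) = ν₀ * Q + p by rw [hp']; ring]
      linear_combination (-Ψ (ket b)) * hscalar
    have h' := congrArg (fun x => a * x) hket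
    simp only [mul_add, mul_sub, Finset.mul_sum] at h'
    simp only [mul_add]
    refine Eq.trans (by ring) (h'.trans ?_)
    congr 1
    · congr 1
      · refine Finset.sum_congr rfl fun j _ => ?_
        simp only [hV]
        ring
      · ring
    · ring

end

/-! ### Two species of anyons -/

/-- The charges `r` of the first species followed by the charges `-s` of the second. -/
def speciesCharge (r s : ℤ) (N M : ℕ) : Fin (N + M) → ℤ :=
  Fin.append (fun _ => r) (fun _ => -s)

lemma anyonFactors_eq (ν₀ : ℝ) (r s : ℤ) {N M : ℕ} (p : (Fin N → ℂ) × (Fin M → ℂ)) :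
    anyonFactors ν₀ r s p = List.ofFn fun j =>
      vertex ν₀ (speciesCharge r s N M j) (Fin.append p.1 p.2 j) := by
  rw [anyonFactors, ← List.ofFn_fin_append]
  congr 1
  funext j
  refine Fin.addCases (fun i => ?_) (fun i => ?_) j <;> simp [speciesCharge]

lemma append_update_left {N M : ℕ} (x : Fin N → ℂ) (y : Fin M → ℂ) (j : Fin N) (t : ℂ) :
    Fin.append (Function.update x j t) y =
      Function.update (Fin.append x y) (Fin.castAdd M j) t := by
  funext i
  refine Fin.addCases (fun i => ?_) (fun i => ?_) i
  · simp [Function.update_apply]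
  · have : Fin.natAdd N i ≠ Fin.castAdd M j := by
      intro h
      have := congrArg Fin.val h
      simp at this
      omega
    simp [this]

lemma append_update_right {N M : ℕ} (x : Fin N → ℂ) (y : Fin M → ℂ) (j : Fin M) (t : ℂ) :
    Fin.append x (Function.update y j t) =
      Function.update (Fin.append x y) (Fin.natAdd N j) t := by
  funext i
  refine Fin.addCases (fun i => ?_) (fun i => ?_) i
  · have : Fin.castAdd M i ≠ Fin.natAdd N j := by
      intro h
      have := congrArg Fin.val h
      simp at this
      omega
    simp [this]
  · simp [Function.update_apply]

lemma sum_Ioi_append {N M : ℕ} (F : Fin (N + M) → Fin (N + M) → ℂ) :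
    ∑ j, ∑ k ∈ Finset.Ioi j, F j k =
      ∑ j : Fin N, ∑ k ∈ Finset.Ioi j, F (Fin.castAdd M j) (Fin.castAdd M k) +
      ∑ j : Fin M, ∑ k ∈ Finset.Ioi j, F (Fin.natAdd N j) (Fin.natAdd N k) +
      ∑ j : Fin N, ∑ k : Fin M, F (Fin.castAdd M j) (Fin.natAdd N k) := by
  have h : ∀ {K : ℕ} (G : Fin K → Fin K → ℂ), ∑ j, ∑ k ∈ Finset.Ioi j, G j k =
      ∑ j, ∑ k, if j < k then G j k else 0 := fun G => by
    refine Finset.sum_congr rfl fun j _ => ?_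
    rw [← Finset.sum_filter]
    congr 1
    ext k
    simp
  have h1 : ∀ (j : Fin N) (k : Fin M), Fin.castAdd M j < Fin.natAdd N k := fun j k => by
    rw [Fin.lt_def]
    simp only [Fin.val_castAdd, Fin.val_natAdd]
    omega
  have h2 : ∀ j k : Fin N, Fin.castAdd M j < Fin.castAdd M k ↔ j < k := fun _ _ => Iff.rfl
  have h3 : ∀ j k : Fin M, Fin.natAdd N j < Fin.natAdd N k ↔ j < k := fun j k => by
    rw [Fin.lt_def, Fin.lt_def]
    simp
  rw [h, h, h]
  simp only [Fin.sum_univ_add, h1, h2, h3, (h1 _ _).not_gt, if_true, if_false,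
    Finset.sum_add_distrib, Finset.sum_const_zero]
  ring

end

end ChiralBoson

open ChiralBoson
theorem theorem3p1 (ν₀ ν : ℝ) (r s : ℤ) (hν₀ : 0 < ν₀) (hν : ν ≠ 0)
    (hr : ν = r * ν₀) (hs : 1 / ν = s * ν₀) (N M : ℕ) (Q : ℤ) :
    -- on the domain, the product of vertex operators and all commutators are well-defined forms
    (∀ p ∈ orderedDomain N M,
      QForm.ListProdDefined (anyonFactors ν₀ r s p) ∧
      QForm.CommutatorDefined (H₁ ν₀ ν) (anyonProduct ν₀ r s p) ∧
      QForm.CommutatorDefined (H₂ ν₀) (anyonProduct ν₀ r s p) ∧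
      QForm.CommutatorDefined (H₃ ν₀ ν) (anyonProduct ν₀ r s p)) ∧
    -- the matrix elements are holomorphic functions of all the positions
    (∀ η : FiniteState, DifferentiableOn ℂ
      (fun p => (anyonProduct ν₀ r s p).eval η (chargeState Q)) (orderedDomain N M)) ∧
    -- the three commutation relations
    (∀ η : FiniteState, ∀ p ∈ orderedDomain N M,
      (QForm.commutator (H₁ ν₀ ν) (anyonProduct ν₀ r s p)).eval η (chargeState Q) =
        ((N : ℂ) - (M : ℂ) * ((ν : ℂ) ^ 2)⁻¹) *
          (anyonProduct ν₀ r s p).eval η (chargeState Q) ∧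
      (QForm.commutator (H₂ ν₀) (anyonProduct ν₀ r s p)).eval η (chargeState Q) =
        -momentumOp (fun p' => (anyonProduct ν₀ r s p').eval η (chargeState Q)) p ∧
      (QForm.commutator (H₃ ν₀ ν) (anyonProduct ν₀ r s p)).eval η (chargeState Q) =
        deformedCS ((ν : ℂ) ^ 2)
            (fun p' => (anyonProduct ν₀ r s p').eval η (chargeState Q)) p +
          (1 / 12) * ((ν : ℂ) ^ 2 - ((ν : ℂ) ^ 2)⁻¹) * (M : ℂ) *
            (anyonProduct ν₀ r s p).eval η (chargeState Q)) := by
  have hνc : (ν : ℂ) ≠ 0 := by exact_mod_cast hν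
  have hr' : (r : ℂ) * ν₀ = ν := by rw [hr]; push_cast; rfl
  have hs' : ((-s : ℤ) : ℂ) * ν₀ = -(1 / ν) := by
    have h : (1 / ν : ℂ) = s * ν₀ := by exact_mod_cast hs
    rw [h]
    push_cast
    ring
  set ℓ := speciesCharge r s N M with hℓ
  have hℓ₁ : ∀ j, (ℓ (Fin.castAdd M j) : ℂ) * ν₀ = ν := fun j => by
    rw [hℓ, speciesCharge, Fin.append_left, hr']
  have hℓ₂ : ∀ k, (ℓ (Fin.natAdd N k) : ℂ) * ν₀ = -(1 / ν) := fun k => by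
    rw [hℓ, speciesCharge, Fin.append_right, hs']
  have hprod : ∀ p : (Fin N → ℂ) × (Fin M → ℂ),
      anyonProduct ν₀ r s p = vertexProduct ν₀ ℓ (Fin.append p.1 p.2) := fun p => by
    rw [anyonProduct, anyonFactors_eq, vertexProduct]
  have heval : ∀ (η : FiniteState) (p : (Fin N → ℂ) × (Fin M → ℂ)),
      (anyonProduct ν₀ r s p).eval η (chargeState Q) =
        vertexFunctional ν₀ ℓ Q (Fin.append p.1 p.2) (conjState η) := fun η p => by
    rw [eval_chargeState, hprod, vertexFunctional]
  refine ⟨fun p hp => ⟨?_, commutatorDefined (isTranspose_H₁ ν₀ ν) _,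
    commutatorDefined (isTranspose_H₂ ν₀) _, commutatorDefined (isTranspose_H₃ ν₀ ν) _⟩,
    fun η => ?_, fun η p hp => ?_⟩
  · rw [anyonFactors_eq]
    exact (vertexProduct_spec ν₀ ℓ _ hp.2).1
  · simp only [heval]
    refine differentiableOn_vertexFunctional ν₀ ℓ Q (fun j => ?_) (fun p hp => hp.2) _
    refine Fin.addCases (fun i => ?_) (fun i => ?_) j
    · simp only [Fin.append_left]
      fun_prop
    · simp only [Fin.append_right]
      fun_prop
  · have hu : StrictAnti fun j => (Fin.append p.1 p.2 j).im := hp.2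
    rw [eval_commutator_chargeState (isTranspose_H₁ ν₀ ν) _ (H₁_ket ν₀ ν (Q, 0)),
      eval_commutator_chargeState (isTranspose_H₂ ν₀) _ (H₂_vacuum ν₀ Q),
      eval_commutator_chargeState (isTranspose_H₃ ν₀ ν) _ (H₃_vacuum ν₀ ν Q)]
    have hfold : matrixElement (anyonProduct ν₀ r s p) Q =
        vertexFunctional ν₀ ℓ Q (Fin.append p.1 p.2) := by rw [hprod, vertexFunctional]
    simp only [heval, deformedCS, momentumOp, hfold]
    generalize conjState η = ξ
    have hx : ∀ k j, partialX k j (fun p' : (Fin N → ℂ) × (Fin M → ℂ) =>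
        vertexFunctional ν₀ ℓ Q (Fin.append p'.1 p'.2) ξ) p = iteratedDeriv k (fun t =>
        vertexFunctional ν₀ ℓ Q (Function.update (Fin.append p.1 p.2) (Fin.castAdd M j) t) ξ)
          (Fin.append p.1 p.2 (Fin.castAdd M j)) := fun k j => by
      simp only [partialX, append_update_left, Fin.append_left]
    have hy : ∀ k j, partialY k j (fun p' : (Fin N → ℂ) × (Fin M → ℂ) =>
        vertexFunctional ν₀ ℓ Q (Fin.append p'.1 p'.2) ξ) p = iteratedDeriv k (fun t =>
        vertexFunctional ν₀ ℓ Q (Function.update (Fin.append p.1 p.2) (Fin.natAdd N j) t) ξ)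
          (Fin.append p.1 p.2 (Fin.natAdd N j)) := fun k j => by
      simp only [partialY, append_update_right, Fin.append_right]
    simp only [hx, hy]
    refine ⟨?_, ?_, ?_⟩
    · rw [(vertexFunctional_isCoherent ν₀ ℓ Q hu).H₁ ν₀ ν ξ, ← sub_mul]
      congr 1
      have h1 : ν₀ * ((Q : ℂ) + ∑ j, (ℓ j : ℂ)) = ν₀ * Q + (N * ν - M * (1 / ν)) := by
        rw [mul_add, Finset.mul_sum, Fin.sum_univ_add]
        simp only [mul_comm (ν₀ : ℂ), hℓ₁, hℓ₂, Finset.sum_const, Finset.card_univ,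
          Fintype.card_fin, nsmul_eq_mul]
        ring
      rw [h1]
      field_simp
      ring
    · simp only [iteratedDeriv_one_vertexFunctional ν₀ ℓ Q hu]
      rw [vertexFunctional_H₂ ν₀ ℓ Q hu ξ, Fin.sum_univ_add]
      simp only [mul_assoc, ← Finset.mul_sum, neg_mul, Finset.sum_neg_distrib]
      have h : ∀ S T : ℂ, S + T = -(-(Complex.I * (-(Complex.I * S) + -(Complex.I * T)))) :=
        fun S T => by linear_combination (S + T) * Complex.I_mul_I
      exact h _ _
    · have hμ : ∀ j, (ν : ℂ) * (1 - (ℓ j * ν₀ : ℂ) ^ 2) = (1 - (ν : ℂ) ^ 2) * (ℓ j * ν₀ : ℂ) := by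
        intro j
        refine Fin.addCases (fun i => ?_) (fun i => ?_) j
        · rw [hℓ₁]
          ring
        · rw [hℓ₂]
          field_simp
          ring
      simp only [iteratedDeriv_two_vertexFunctional ν₀ ℓ Q hu]
      rw [vertexFunctional_H₃ ν₀ ℓ Q hu hμ ξ, sum_Ioi_append]
      set u := Fin.append p.1 p.2 with hu'
      set Ψ := vertexFunctional ν₀ ℓ Q u
      -- `T j` is the kinetic term, in the form `-(1 / μⱼ) ∂ⱼ ^ 2 Ψ`
      obtain ⟨T, hT⟩ : ∃ T : Fin (N + M) → ℂ, ∀ j, (∑ k, (ℓ k * ν₀ : ℂ) *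
          (pairWeight u j k * pairWeight u k j) - ℓ j * ν₀ / 4) * Ψ ξ + Ψ (modeFieldDeriv (u j) ξ) +
          ℓ j * ν₀ * (localMomentum ν₀ ℓ Q u j ^ 2 * Ψ ξ +
            2 * localMomentum ν₀ ℓ Q u j * Ψ (modeField (u j) ξ) +
            Ψ (modeField (u j) (modeField (u j) ξ))) = T j := ⟨_, fun _ => rfl⟩
      simp only [hT]
      simp only [Fin.sum_univ_add, hℓ₁, hℓ₂, hu', Fin.append_left, Fin.append_right]
      have h1 : (ν : ℂ) ^ 2 * ∑ k, -(-(1 / (ν : ℂ))) * T (Fin.natAdd N k) =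
          ∑ k, ν * T (Fin.natAdd N k) := by
        rw [Finset.mul_sum]
        refine Finset.sum_congr rfl fun k _ => ?_
        field_simp
      have h2 : -(ν / 2 * (ν + ν) * (1 - ν * ν)) = (ν : ℂ) ^ 2 * ((ν : ℂ) ^ 2 - 1) := by ring
      have h3 : -(ν / 2 * (-(1 / (ν : ℂ)) + -(1 / ν)) * (1 - -(1 / (ν : ℂ)) * -(1 / ν))) =
          ((ν : ℂ) ^ 2 - 1) / (ν : ℂ) ^ 2 := by
        field_simp
        ring
      have h4 : -(ν / 2 * ((ν : ℂ) + -(1 / ν)) * (1 - ν * -(1 / ν))) = 1 - (ν : ℂ) ^ 2 := by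
        field_simp
        ring
      have h5 : ((ν : ℂ) * (∑ _j : Fin N, (ν : ℂ) ^ 3 + ∑ _k : Fin M, (-(1 / (ν : ℂ))) ^ 3) -
          ν ^ 3 * (∑ _j : Fin N, (ν : ℂ) + ∑ _k : Fin M, -(1 / (ν : ℂ)))) / 12 =
          1 / 12 * ((ν : ℂ) ^ 2 - ((ν : ℂ) ^ 2)⁻¹) * M := by
        simp only [Finset.sum_const, Finset.card_univ, Fintype.card_fin, nsmul_eq_mul]
        field_simp
        ring
      rw [h1, h2, h3, h4, h5]
      simp only [neg_mul, Finset.sum_neg_distrib]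
      ring
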